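/- Let $\Omega$ be a compact metric space, $T:\Omega\to\Omega$ a homeomorphism, and $\mu$ a non-atomic $T$-ergodic Borel probability measure on $\Omega$. For $f\in L^\infty(\Omega,\mu)$ real-valued, $E\in\mathbb C$ and $n\ge 1$ put $$S_{f,E}(\omega)=\begin{pmatrix}E-f(\omega)&-1\\1&0\end{pmatrix},\qquad S^n_{f,E}(\omega)=S_{f,E}(T^{n-1}\omega)\cdots S_{f,E}(\omega),$$ $$\gamma_f(E)=\lim_{n\to\infty}\frac1n\int_\Omega\ln\|S^n_{f,E}(\omega)\|\,d\mu(\omega),\qquad M(f)=\left|\{E\in\mathbb R:\gamma_f(E)=0\}\right|,$$ where $|\cdot|$ is Lebesgue measure. For $r>0$ let $X_r=\{f\in L^1(\Omega,\mu):\|f\|_\infty\le r\}$, with the metric given by the $L^1$ norm. Then for every $r>0$ and $\Lambda>0$ these quantities are well defined for $f \in X_r$ (the integrals converge and the limit defining $\gamma_f(E)$ exists for every $E\in\mathbb C$; the set $\{E\in\mathbb R:\gamma_f(E)=0\}$ is Borel and of finite measure; and $\lambda\mapsto M(\lambda f)$ is integrable on $[0,\Lambda]$), and the two maps $$X_r\to\mathbb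 R,\quad f\mapsto M(f),\qquad\text{and}\qquad X_r\to\mathbb R,\quad f\mapsto\int_0^\Lambda M(\lambda f)\,d\lambda$$ are upper semicontinuous. -/

import Mathlib

open MeasureTheory Filter Topology

noncomputable section

namespace SchrodingerCocycle

variable {Ω : Type*}

/-- The one-step transfer matrix of the Schrodinger operator with sampling function `f` at the
complex energy `E`. -/
def transfer (f : Ω → ℝ) (E : ℂ) (ω : Ω) : Matrix (Fin 2) (Fin 2) ℂ :=
  !![E - (f ω : ℂ), -1; 1, 0]

/-- The iterated transfer matrix `S(T^(n-1) ω) * ... * S(T ω) * S(ω)`. -/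
def iterTransfer (T : Ω → Ω) (f : Ω → ℝ) (E : ℂ) : ℕ → Ω → Matrix (Fin 2) (Fin 2) ℂ
  | 0, _ => 1
  | n + 1, ω => transfer f E (T^[n] ω) * iterTransfer T f E n ω

open scoped Matrix.Norms.L2Operator in
/-- The logarithm of the norm (the operator norm on Euclidean space) of the iterated transfer
matrix. -/
def logNorm (T : Ω → Ω) (f : Ω → ℝ) (E : ℂ) (n : ℕ) (ω : Ω) : ℝ :=
  Real.log ‖iterTransfer T f E n ω‖

variable [MeasurableSpace Ω]

/-- The averages `(1 / n) ∫ log ‖S^n(ω)‖ dμ(ω)` (with the irrelevant value `0` at `n = 0`). -/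
def lyapunovSeq (T : Ω → Ω) (μ : Measure Ω) (f : Ω → ℝ) (E : ℂ) (n : ℕ) : ℝ :=
  (1 / (n : ℝ)) * ∫ ω, logNorm T f E n ω ∂μ

/-- The Lyapunov exponent. -/
def lyapunov (T : Ω → Ω) (μ : Measure Ω) (f : Ω → ℝ) (E : ℂ) : ℝ :=
  limUnder atTop (lyapunovSeq T μ f E)

/-- The set of real energies at which the Lyapunov exponent vanishes. -/
def zeroSet (T : Ω → Ω) (μ : Measure Ω) (f : Ω → ℝ) : Set ℝ :=
  {E : ℝ | lyapunov T μ f (E : ℂ) = 0}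

/-- The Lebesgue measure of the set of real energies at which the Lyapunov exponent vanishes. -/
def zeroMeasure (T : Ω → Ω) (μ : Measure Ω) (f : Ω → ℝ) : ℝ :=
  volume.real (zeroSet T μ f)

/-- The elements of `L¹(μ)` whose essential supremum norm is at most `r`; as a subset of
`Lp ℝ 1 μ` it carries the topology of the `L¹` norm. -/
def linftyBall (μ : Measure Ω) (r : ℝ) : Set (Lp ℝ 1 μ) :=
  {f | eLpNorm f ⊤ μ ≤ ENNReal.ofReal r}

end SchrodingerCocycle

end

/-! ### Poisson integrals of logarithms on the real line -/

namespace SchrodingerCocycle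

/-! Subadditivity makes the Lyapunov exponent an infimum of finite averages, each continuous along
bounded, almost everywhere convergent sequences of potentials. So at every energy it is upper
semicontinuous in the potential, whereas vanishing on a large set is stable only if the exponent
cannot drop in the limit. The missing lower bound holds in the mean over real energies.

It comes from harmonicity. The first entry of the transfer matrix is a polynomial in the energy with
real roots, so its log-modulus is reproduced by Poisson integrals. Off the real axis this entry
controls the whole norm (`norm_step_le`). Passing to the limit, the Poisson integral seen from `2i`
of the exponent on the real line is its value at `2i` (`integral_lyapunov`). Height `2` is
convenient because off-diagonal entries there are at most half the first one. The logarithms of the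
norms are then both sub- and superadditive up to a constant, so the averages converge uniformly in
the potential and the exponent is continuous (`tendsto_lyapunov_of_ae`).

Hence the integrals of the differences of exponents tend to zero, and so do those of their positive
parts, by semicontinuity and domination. This is convergence in `L¹` of the Cauchy distribution
(`tendsto_integral_abs_lyapunov_sub`). Zero sets lie in a fixed bounded interval, so Markov's
inequality gives the first claim (`eventually_zeroMeasure_lt`), and dominated convergence in the
coupling gives the second. An `L¹`-convergent sequence has an almost everywhere convergent
subsequence, which is enough. -/

open Complex in
/-- The Cayley transform, mapping the unit circle to the real line and `0` to `2 i`, linearises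
the distance to a point of the closed lower half-plane. -/
lemma norm_cayley_mul {x y θ : ℝ} (hy : 0 ≤ y) (hθ : θ ∈ Set.Ioo 0 (2 * Real.pi)) :
    ‖((2 * Real.tan ((θ - Real.pi) / 2) : ℝ) : ℂ) + y * I - x‖ * ‖circleMap 0 1 θ - 1‖ =
      ‖(2 + y) * I - x‖ * ‖circleMap 0 1 θ - (-(y - 2) * I - x) / (-(2 + y) * I - x)‖ := by
  set c := Real.cos ((θ - Real.pi) / 2) with hc
  set s := Real.sin ((θ - Real.pi) / 2) with hs
  have hc0 : 0 < c := Real.cos_pos_of_mem_Ioo ⟨by linarith [hθ.1], by linarith [hθ.2]⟩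
  -- With `φ = (θ - π) / 2` the circle point is `-exp (2iφ)` and the real point is `2 tan φ`, so
  -- everything becomes algebraic in `c = cos φ` and `s = sin φ`.
  have hw : circleMap 0 1 θ = -((c : ℂ) + s * I) ^ 2 := by
    rw [hc, hs, ofReal_cos, ofReal_sin, ← exp_mul_I, ← exp_nat_mul]
    have : ((2 : ℕ) : ℂ) * (((θ - Real.pi) / 2 : ℝ) * I) = θ * I - Real.pi * I := by
      push_cast; ring
    rw [this, exp_sub, exp_pi_mul_I]
    simp [circleMap, div_neg]
  have hcs : (c : ℂ) ^ 2 + (s : ℂ) ^ 2 = 1 := by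
    have : c ^ 2 + s ^ 2 = 1 := Real.cos_sq_add_sin_sq _
    exact_mod_cast this
  have hw1 : ‖circleMap 0 1 θ‖ = 1 := by simp
  have hβ : -(2 + y) * I - x ≠ (0 : ℂ) := by
    intro h
    have := congrArg im h
    simp at this
    linarith
  have hββ : ‖(2 + y) * I - x‖ = ‖-(2 + y) * I - (x : ℂ)‖ := by
    rw [← norm_conj]; congr 1; simp [map_ofNat]; ring
  have hc' : (c : ℂ) ≠ 0 := by exact_mod_cast hc0.ne'
  have hE : ((2 * Real.tan ((θ - Real.pi) / 2) : ℝ) : ℂ) = 2 * s / c := by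
    rw [Real.tan_eq_sin_div_cos, ← hc, ← hs]; push_cast; ring
  have hconj : (starRingEnd ℂ) (circleMap 0 1 θ) * circleMap 0 1 θ = 1 := by
    rw [conj_mul', hw1]; simp
  have key : ((2 * s / c : ℂ) + y * I - x) * (circleMap 0 1 θ - 1) =
      ((y - 2) * I - x) * circleMap 0 1 θ - ((2 + y) * I - x) := by
    rw [hw]
    field_simp
    linear_combination (2 * s - 2 * c * I) * hcs +
      (-4 * s * c ^ 2 - 2 * s ^ 2 * c * I - 2 * s ^ 3) * I_sq
  rw [hE, ← norm_mul, key, hββ, ← norm_mul, mul_sub, mul_div_cancel₀ _ hβ]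
  generalize circleMap 0 1 θ = w at *
  rw [← norm_conj, ← mul_one ‖(starRingEnd ℂ) _‖, ← hw1, ← norm_mul, ← norm_neg]
  congr 1
  simp only [map_sub, map_mul, conj_I, conj_ofReal, map_add, map_ofNat]
  linear_combination ((y - 2) * I + x) * hconj

/-- The Cauchy distribution with scale `2`, the harmonic measure of the upper half-plane seen
from `2 i`. -/
noncomputable abbrev harmonicMeasure : Measure ℝ := ProbabilityTheory.cauchyMeasure 0 2

lemma harmonicMeasure_eq : harmonicMeasure =
    volume.withDensity fun E => ENNReal.ofReal (Real.pi⁻¹ * 2 * (E ^ 2 + 4)⁻¹) := by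
  rw [harmonicMeasure, ProbabilityTheory.cauchyMeasure_of_scale_ne_zero _ two_ne_zero]
  congr 1
  ext E
  rw [ProbabilityTheory.cauchyPDF, ProbabilityTheory.cauchyPDFReal_def]
  norm_num

open Real in
/-- The tangent of half the angle parametrises the real line by the punctured circle. -/
lemma image_tan_half :
    (fun θ => 2 * tan ((θ - π) / 2)) '' Set.Ioo 0 (2 * π) = Set.univ := by
  refine Set.eq_univ_of_forall fun E => ⟨2 * arctan (E / 2) + π, ⟨?_, ?_⟩, ?_⟩
  · linarith [neg_pi_div_two_lt_arctan (E / 2)]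
  · linarith [arctan_lt_pi_div_two (E / 2)]
  · simp only [add_sub_cancel_right, mul_div_cancel_left₀ _ (two_ne_zero' ℝ), tan_arctan]
    ring

open Real in
lemma injOn_tan_half : Set.InjOn (fun θ => 2 * tan ((θ - π) / 2)) (Set.Ioo 0 (2 * π)) := by
  intro a ha b hb h
  have := injOn_tan (x₁ := (a - π) / 2) (x₂ := (b - π) / 2)
    ⟨by linarith [ha.1], by linarith [ha.2]⟩ ⟨by linarith [hb.1], by linarith [hb.2]⟩
    (by simpa using h)
  linarith

open Real in
lemma hasDerivWithinAt_tan_half {θ : ℝ} (hθ : θ ∈ Set.Ioo 0 (2 * π)) :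
    HasDerivWithinAt (fun θ => 2 * tan ((θ - π) / 2)) (1 / cos ((θ - π) / 2) ^ 2)
      (Set.Ioo 0 (2 * π)) θ := by
  have hc0 : 0 < cos ((θ - π) / 2) :=
    cos_pos_of_mem_Ioo ⟨by linarith [hθ.1], by linarith [hθ.2]⟩
  have h := (((hasDerivAt_tan hc0.ne').comp θ
    (((hasDerivAt_id θ).sub_const π).div_const 2)).const_mul 2)
  exact (h.congr_deriv (by ring)).hasDerivWithinAt

-- The Jacobian cancels the Cauchy density: the parametrisation carries the uniform probability on
-- the circle to `harmonicMeasure`.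
open Real in
lemma abs_deriv_mul_density {θ : ℝ} (hθ : θ ∈ Set.Ioo 0 (2 * π)) :
    |1 / cos ((θ - π) / 2) ^ 2| * (π⁻¹ * 2 * ((2 * tan ((θ - π) / 2)) ^ 2 + 4)⁻¹) =
      (2 * π)⁻¹ := by
  have hc0 : 0 < cos ((θ - π) / 2) :=
    cos_pos_of_mem_Ioo ⟨by linarith [hθ.1], by linarith [hθ.2]⟩
  have h1 : (2 * tan ((θ - π) / 2)) ^ 2 + 4 = 4 / cos ((θ - π) / 2) ^ 2 := by
    rw [tan_eq_sin_div_cos]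
    field_simp
    linear_combination 4 * sin_sq_add_cos_sq ((θ - π) / 2)
  rw [h1, abs_of_pos (by positivity)]
  field_simp
  norm_num

open Real in
lemma integrable_harmonicMeasure_iff (g : ℝ → ℝ) : Integrable g harmonicMeasure ↔
    IntegrableOn (fun θ => g (2 * tan ((θ - π) / 2))) (Set.Ioo 0 (2 * π)) := by
  rw [harmonicMeasure_eq, integrable_withDensity_iff_integrable_smul' (by fun_prop) (by simp),
    ← integrableOn_univ, ← image_tan_half, integrableOn_image_iff_integrableOn_abs_deriv_smul
      measurableSet_Ioo (fun _ => hasDerivWithinAt_tan_half) injOn_tan_half]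
  have : Set.EqOn (fun θ => |1 / cos ((θ - π) / 2) ^ 2| • (ENNReal.ofReal (π⁻¹ * 2 *
      ((2 * tan ((θ - π) / 2)) ^ 2 + 4)⁻¹)).toReal • g (2 * tan ((θ - π) / 2)))
      (fun θ => (2 * π)⁻¹ • g (2 * tan ((θ - π) / 2))) (Set.Ioo 0 (2 * π)) := by
    intro θ hθ
    beta_reduce
    rw [ENNReal.toReal_ofReal (by positivity), smul_smul, ← abs_deriv_mul_density hθ]
  rw [integrableOn_congr_fun this measurableSet_Ioo]
  exact integrable_smul_iff (by positivity : (2 * π)⁻¹ ≠ 0) _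

open Real in
lemma integral_harmonicMeasure (g : ℝ → ℝ) : ∫ E, g E ∂harmonicMeasure =
    (2 * π)⁻¹ * ∫ θ in Set.Ioo 0 (2 * π), g (2 * tan ((θ - π) / 2)) := by
  rw [harmonicMeasure_eq, integral_withDensity_eq_integral_toReal_smul (by fun_prop) (by simp),
    ← setIntegral_univ, ← image_tan_half, integral_image_eq_integral_abs_deriv_smul
      measurableSet_Ioo (fun _ => hasDerivWithinAt_tan_half) injOn_tan_half,
    ← integral_const_mul]
  refine setIntegral_congr_fun measurableSet_Ioo fun θ hθ => ?_
  rw [ENNReal.toReal_ofReal (by positivity), smul_smul, ← abs_deriv_mul_density hθ, smul_eq_mul]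

open Complex in
lemma log_norm_cayley {x y : ℝ} (hy : 0 ≤ y) :
    (fun θ : ℝ => Real.log ‖((2 * Real.tan ((θ - Real.pi) / 2) : ℝ) : ℂ) + y * I - x‖)
      =ᵐ[volume.restrict (Set.Ioo 0 (2 * Real.pi))]
    fun θ : ℝ => Real.log ‖(2 + y) * I - x‖ +
      Real.log ‖circleMap 0 1 θ - (-(y - 2) * I - x) / (-(2 + y) * I - x)‖ -
        Real.log ‖circleMap 0 1 θ - 1‖ := by
  rw [EventuallyEq, ae_restrict_iff' measurableSet_Ioo]
  -- The removed angle corresponds to the real point `x`; for `y = 0` the left logarithm has the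
  -- default value `0` there.
  filter_upwards [compl_mem_ae_iff.2 (measure_singleton (2 * Real.arctan (x / 2) + Real.pi))]
    with θ hne hθ
  have hβ : (2 + y) * I - x ≠ (0 : ℂ) := by
    intro h
    have := congrArg im h
    simp at this
    linarith
  have hE : ((2 * Real.tan ((θ - Real.pi) / 2) : ℝ) : ℂ) + y * I - x ≠ 0 := by
    intro h
    have := congrArg re h
    simp only [add_re, sub_re, ofReal_re, mul_re, I_re, I_im, ofReal_im, zero_re] at this
    have h1 : Real.tan ((θ - Real.pi) / 2) = x / 2 := by linarith
    apply hne
    rw [← h1, Real.arctan_tan (by linarith [hθ.1]) (by linarith [hθ.2])]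
    simp
    ring
  have h1 : circleMap 0 1 θ - 1 ≠ 0 := by
    intro h
    have : circleMap 0 1 θ = circleMap 0 1 0 := by simpa [circleMap, sub_eq_zero] using h
    have hi := injOn_circleMap_of_abs_sub_le' (c := 0) (R := 1) (a := 0) (b := 2 * Real.pi)
      one_ne_zero (by linarith)
    have := hi ⟨hθ.1.le, hθ.2⟩ ⟨le_rfl, by positivity⟩ this
    exact hθ.1.ne' this
  have h := norm_cayley_mul (x := x) hy hθ
  have h2 : ‖circleMap 0 1 θ - (-(y - 2) * I - x) / (-(2 + y) * I - x)‖ ≠ 0 := by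
    intro h0
    rw [h0, mul_zero, mul_eq_zero, norm_eq_zero, norm_eq_zero] at h
    tauto
  have h' := congrArg Real.log h
  rw [Real.log_mul (norm_ne_zero_iff.2 hE) (norm_ne_zero_iff.2 h1),
    Real.log_mul (norm_ne_zero_iff.2 hβ) h2] at h'
  linarith

open Complex in
lemma integrable_log_norm {x y : ℝ} (hy : 0 ≤ y) :
    Integrable (fun E : ℝ => Real.log ‖(E : ℂ) + y * I - x‖) harmonicMeasure := by
  have hc (a : ℂ) : IntegrableOn (fun θ : ℝ => Real.log ‖circleMap 0 1 θ - a‖)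
      (Set.Ioo 0 (2 * Real.pi)) := by
    have := circleIntegrable_log_norm_sub_const (a := a) (c := 0) 1
    rw [CircleIntegrable, intervalIntegrable_iff_integrableOn_Ioo_of_le (by positivity)] at this
    exact this
  rw [integrable_harmonicMeasure_iff]
  refine Integrable.congr ?_ (log_norm_cayley hy).symm
  exact ((integrable_const _).add (hc _)).sub (hc _)

open Complex in
/-- The Poisson integral formula for the logarithmic potential of a real point. -/
lemma integral_log_norm {x y : ℝ} (hy : 0 ≤ y) :
    ∫ E : ℝ, Real.log ‖(E : ℂ) + y * I - x‖ ∂harmonicMeasure =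
      Real.log ‖(2 + y) * I - x‖ := by
  have hc (a : ℂ) : IntegrableOn (fun θ : ℝ => Real.log ‖circleMap 0 1 θ - a‖)
      (Set.Ioo 0 (2 * Real.pi)) := by
    have := circleIntegrable_log_norm_sub_const (a := a) (c := 0) 1
    rw [CircleIntegrable, intervalIntegrable_iff_integrableOn_Ioo_of_le (by positivity)] at this
    exact this
  have hi (a : ℂ) (ha : ‖a‖ ≤ 1) :
      ∫ θ in Set.Ioo 0 (2 * Real.pi), Real.log ‖circleMap 0 1 θ - a‖ = 0 := by
    have h := circleAverage_log_norm_sub_const_of_mem_closedBall (a := a) (c := 0) (R := 1)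
      (by simpa using ha)
    rw [Real.circleAverage_def, Real.log_one, smul_eq_mul, mul_eq_zero,
      intervalIntegral.integral_of_le (by positivity), integral_Ioc_eq_integral_Ioo] at h
    exact h.resolve_left (by positivity)
  -- This is the Cayley image of `x - iy`, a point of the closed lower half-plane, so it lies in the
  -- closed disc and the circle average of the logarithm is `log 1 = 0`.
  have hκ : ‖(-(y - 2) * I - x : ℂ) / (-(2 + y) * I - x)‖ ≤ 1 := by
    rw [norm_div]
    refine div_le_one_of_le₀ ?_ (norm_nonneg _)
    rw [← sq_le_sq₀ (norm_nonneg _) (norm_nonneg _), ← normSq_eq_norm_sq, ← normSq_eq_norm_sq]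
    simp only [normSq_apply, sub_re, sub_im, neg_re, neg_im, add_re, add_im, mul_re, mul_im,
      ofReal_re, ofReal_im, I_re, I_im, re_ofNat, im_ofNat]
    nlinarith
  have hadd := (integrable_const (μ := volume.restrict (Set.Ioo 0 (2 * Real.pi)))
    (Real.log ‖(2 + y) * I - x‖)).add (hc ((-(y - 2) * I - x) / (-(2 + y) * I - x)))
  rw [integral_harmonicMeasure, integral_congr_ae (log_norm_cayley hy)]
  erw [integral_sub hadd (hc 1)]
  rw [integral_add' (integrable_const _) (hc _), hi _ hκ, hi 1 (by simp)]
  simp [Real.pi_pos.le]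
  field_simp

/-- On bounded sets the Lebesgue measure is controlled by the harmonic measure. -/
lemma volume_le_harmonicMeasure (R : ℝ) {A : Set ℝ} (hA : A ⊆ Set.Icc (-R) R)
    (hAm : MeasurableSet A) :
    volume A ≤ ENNReal.ofReal (Real.pi * (R ^ 2 + 4) / 2) * harmonicMeasure A := by
  rw [harmonicMeasure_eq, withDensity_apply _ hAm, ← lintegral_const_mul _ (by fun_prop),
    ← setLIntegral_one]
  refine setLIntegral_mono (by fun_prop) fun E hE => ?_
  rw [← ENNReal.ofReal_mul (by positivity), ← ENNReal.ofReal_one]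
  refine ENNReal.ofReal_le_ofReal ?_
  have : E ^ 2 ≤ R ^ 2 := sq_le_sq' (hA hE).1 (hA hE).2
  have hp := Real.pi_pos
  field_simp
  linarith

end SchrodingerCocycle

/-! ### Entries of the transfer matrices -/

namespace SchrodingerCocycle

section MatrixNorm
open scoped Matrix.Norms.L2Operator

lemma norm_entry_le (A : Matrix (Fin 2) (Fin 2) ℂ) (i j : Fin 2) : ‖A i j‖ ≤ ‖A‖ := by
  have h := Matrix.l2_opNorm_mulVec A (EuclideanSpace.single j 1)
  rw [PiLp.norm_single, norm_one, mul_one] at h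
  refine le_trans ?_ h
  have h2 := PiLp.norm_apply_le (p := 2)
    (WithLp.toLp 2 (Matrix.mulVec A (EuclideanSpace.single j (1 : ℂ)).ofLp)) i
  have h3 : Matrix.mulVec A (EuclideanSpace.single j (1 : ℂ)).ofLp i = A i j := by simp
  rw [← h3]
  exact h2

lemma norm_single_le (i j : Fin 2) (x : ℂ) : ‖Matrix.single i j x‖ ≤ ‖x‖ := by
  rw [Matrix.l2_opNorm_def]
  refine ContinuousLinearMap.opNorm_le_bound _ (norm_nonneg _) fun v => ?_
  have h : ((Matrix.toEuclideanLin (𝕜 := ℂ)).trans LinearMap.toContinuousLinearMap)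
      (Matrix.single i j x) v = EuclideanSpace.single i (x * v j) := by
    ext k
    simp [Matrix.toLpLin_apply, Matrix.single_mulVec, Function.update_apply]
  rw [h, PiLp.norm_single, norm_mul]
  gcongr
  exact PiLp.norm_apply_le v j

lemma norm_le_sum_entries (A : Matrix (Fin 2) (Fin 2) ℂ) :
    ‖A‖ ≤ ‖A 0 0‖ + ‖A 0 1‖ + ‖A 1 0‖ + ‖A 1 1‖ := by
  conv_lhs => rw [Matrix.matrix_eq_sum_single A]
  simp only [Fin.sum_univ_two]
  refine (norm_add_le _ _).trans ?_
  have h := fun i j => norm_single_le i j (A i j)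
  linarith [norm_add_le (Matrix.single (0 : Fin 2) (0 : Fin 2) (A 0 0)) (Matrix.single 0 1 (A 0 1)),
    norm_add_le (Matrix.single (1 : Fin 2) (0 : Fin 2) (A 1 0)) (Matrix.single 1 1 (A 1 1)), h 0 0, h 0 1, h 1 0, h 1 1]

/-- The determinant is a sum of two products of entries. A crude constant suffices, since it
disappears after division by `n`. -/
lemma one_le_two_mul_norm_sq {A : Matrix (Fin 2) (Fin 2) ℂ} (hA : A.det = 1) :
    1 ≤ 2 * ‖A‖ ^ 2 := by
  rw [Matrix.det_fin_two] at hA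
  have h1 : (1 : ℝ) = ‖A 0 0 * A 1 1 - A 0 1 * A 1 0‖ := by rw [hA, norm_one]
  have h2 := norm_sub_le (A 0 0 * A 1 1) (A 0 1 * A 1 0)
  rw [norm_mul, norm_mul] at h2
  have e := norm_entry_le A
  have h3 := mul_le_mul (e 0 0) (e 1 1) (norm_nonneg _) (norm_nonneg _)
  have h4 := mul_le_mul (e 0 1) (e 1 0) (norm_nonneg _) (norm_nonneg _)
  nlinarith

end MatrixNorm

/-- The transfer matrices of the discrete Schrodinger equation with potential `v : ℕ → ℝ`. -/
noncomputable def step (v : ℕ → ℝ) (E : ℂ) : ℕ → Matrix (Fin 2) (Fin 2) ℂ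
  | 0 => 1
  | n + 1 => !![E - v n, -1; 1, 0] * step v E n

lemma iterTransfer_eq_step {Ω : Type*} (T : Ω → Ω) (f : Ω → ℝ) (E : ℂ) (n : ℕ) (ω : Ω) :
    iterTransfer T f E n ω = step (fun k => f (T^[k] ω)) E n := by
  induction n with
  | zero => rfl
  | succ n ih => rw [iterTransfer, step, ih, transfer]

section Step
variable (v : ℕ → ℝ) (E : ℂ) (n m : ℕ)

lemma step_add : step v E (m + n) = step (fun k => v (k + m)) E n * step v E m := by
  induction n with
  | zero => simp [step]
  | succ n ih => rw [← add_assoc, step, step, ih, Matrix.mul_assoc, add_comm m n]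

lemma step_succ' : step v E (n + 1) = step (fun k => v (k + 1)) E n * !![E - v 0, -1; 1, 0] := by
  rw [add_comm, step_add]; simp [step]

lemma det_step : (step v E n).det = 1 := by
  induction n with
  | zero => simp [step]
  | succ n ih => rw [step, Matrix.det_mul, ih, Matrix.det_fin_two_of]; simp

lemma step_succ_00 : step v E (n + 1) 0 0 = (E - v n) * step v E n 0 0 - step v E n 1 0 := by
  simp [step, Matrix.mul_apply, Fin.sum_univ_two]; ring

lemma step_succ_10 : step v E (n + 1) 1 0 = step v E n 0 0 := by
  simp [step, Matrix.mul_apply, Fin.sum_univ_two]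

lemma step_succ_11 : step v E (n + 1) 1 1 = step v E n 0 1 := by
  simp [step, Matrix.mul_apply, Fin.sum_univ_two]

lemma step_succ_00' : step v E (n + 1) 0 0 = (E - v 0) * step (fun k => v (k + 1)) E n 0 0 +
    step (fun k => v (k + 1)) E n 0 1 := by
  simp [step_succ', Matrix.mul_apply, Fin.sum_univ_two]; ring

lemma step_succ_01 : step v E (n + 1) 0 1 = - step (fun k => v (k + 1)) E n 0 0 := by
  simp [step_succ', Matrix.mul_apply, Fin.sum_univ_two]

lemma step_add_00 : step v E (m + n) 0 0 = step (fun k => v (k + m)) E n 0 0 * step v E m 0 0 +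
    step (fun k => v (k + m)) E n 0 1 * step v E m 1 0 := by
  simp [step_add, Matrix.mul_apply, Fin.sum_univ_two]

/-- If `y Im (a b̄) ≥ y² |b|²`, then `|y| |b| ≤ |a|`. -/
lemma abs_mul_norm_le {y : ℝ} {a b : ℂ} (h : y ^ 2 * ‖b‖ ^ 2 ≤ y * (a * (starRingEnd ℂ) b).im) :
    |y| * ‖b‖ ≤ ‖a‖ := by
  have h1 : y * (a * (starRingEnd ℂ) b).im ≤ |y| * (‖a‖ * ‖b‖) := by
    refine (le_abs_self _).trans ?_
    rw [abs_mul]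
    gcongr
    refine (Complex.abs_im_le_norm _).trans ?_
    rw [norm_mul, Complex.norm_conj]
  by_contra! h2
  have hb : 0 < |y| * ‖b‖ := (norm_nonneg a).trans_lt h2
  have := mul_lt_mul_of_pos_right h2 hb
  nlinarith [sq_abs y]

/-- The three-term recurrence reads `c / a = E - x - b / a`. The energy contributes `y` to the
imaginary part and the hypothesis makes `-b / a` contribute with the same sign. -/
lemma herglotz_step {y : ℝ} {a b c : ℂ} (hE : E.im = y) (x : ℝ)
    (h : y ^ 2 * ‖b‖ ^ 2 ≤ y * (a * (starRingEnd ℂ) b).im) (hc : c = (E - x) * a - b) :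
    y ^ 2 * ‖a‖ ^ 2 ≤ y * (c * (starRingEnd ℂ) a).im := by
  have h0 : 0 ≤ y ^ 2 * ‖b‖ ^ 2 := by positivity
  rw [Complex.sq_norm, Complex.normSq_apply] at *
  subst hc
  simp only [Complex.mul_im, Complex.sub_re, Complex.sub_im, Complex.mul_re, Complex.conj_re,
    Complex.conj_im, Complex.ofReal_re, Complex.ofReal_im, hE] at *
  nlinarith

lemma abs_im_mul_norm_step_10_le : |E.im| * ‖step v E n 1 0‖ ≤ ‖step v E n 0 0‖ := by
  refine abs_mul_norm_le ?_
  induction n with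
  | zero => simp [step]
  | succ n ih =>
    rw [step_succ_10]
    exact herglotz_step E rfl (v n) ih (step_succ_00 v E n)

/-- The same invariant, run along the recurrence that peels off the first potential value instead of
the last; the off-diagonal entry changes sign. -/
lemma abs_im_mul_norm_step_01_le : |E.im| * ‖step v E n 0 1‖ ≤ ‖step v E n 0 0‖ := by
  rw [← norm_neg]
  refine abs_mul_norm_le ?_
  induction n generalizing v with
  | zero => simp [step]
  | succ n ih =>
    rw [step_succ_01, neg_neg]
    refine herglotz_step E rfl (v 0) (ih fun k => v (k + 1)) ?_
    rw [step_succ_00', sub_neg_eq_add]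

/-- For positive `n` this chains the two preceding bounds; the summand `E.im ^ 2` on the right
serves only `n = 0`. -/
lemma abs_im_sq_mul_norm_step_11_le :
    E.im ^ 2 * ‖step v E n 1 1‖ ≤ (E.im ^ 2 + 1) * ‖step v E n 0 0‖ := by
  cases n with
  | zero => simp [step]
  | succ n =>
    have h1 := abs_im_mul_norm_step_01_le v E n
    have h2 := abs_im_mul_norm_step_10_le v E (n + 1)
    rw [step_succ_10] at h2
    rw [step_succ_11, ← sq_abs]
    have := mul_le_mul_of_nonneg_left h1 (abs_nonneg E.im)
    nlinarith [norm_nonneg (step v E (n + 1) 0 0), sq_nonneg |E.im|]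

variable {E}

lemma step_00_ne_zero (hE : E.im ≠ 0) : step v E n 0 0 ≠ 0 := by
  induction n with
  | zero => simp [step]
  | succ n ih =>
    intro h
    have := abs_im_mul_norm_step_10_le v E (n + 1)
    rw [step_succ_10, h, norm_zero] at this
    exact absurd this (not_le.2 (mul_pos (abs_pos.2 hE) (norm_pos_iff.2 ih)))

open scoped Matrix.Norms.L2Operator in
/-- Off the real axis the norm of the transfer matrix is comparable to its first entry. -/
lemma norm_step_le {y : ℝ} (hy : 0 < y) (hE : E.im = y) :
    ‖step v E n‖ ≤ (2 + 2 / y + 1 / y ^ 2) * ‖step v E n 0 0‖ := by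
  have h1 := abs_im_mul_norm_step_10_le v E n
  have h2 := abs_im_mul_norm_step_01_le v E n
  have h3 := abs_im_sq_mul_norm_step_11_le v E n
  rw [hE, abs_of_pos hy] at *
  refine (norm_le_sum_entries _).trans ?_
  have h1' : ‖step v E n 1 0‖ ≤ 1 / y * ‖step v E n 0 0‖ := by
    rw [one_div, ← div_eq_inv_mul, le_div_iff₀ hy]; linarith
  have h2' : ‖step v E n 0 1‖ ≤ 1 / y * ‖step v E n 0 0‖ := by
    rw [one_div, ← div_eq_inv_mul, le_div_iff₀ hy]; linarith
  have h3' : ‖step v E n 1 1‖ ≤ (1 + 1 / y ^ 2) * ‖step v E n 0 0‖ := by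
    rw [hE, ← le_div_iff₀' (by positivity)] at h3
    refine h3.trans_eq ?_
    field_simp
  have : 2 / y = 2 * (1 / y) := by ring
  rw [this]
  linarith

/-- At height `2` the first entries of the transfer matrices are almost supermultiplicative. -/
lemma norm_step_mul_le (hE : E.im = 2) : 3 / 4 * (‖step (fun k => v (k + m)) E n 0 0‖ *
    ‖step v E m 0 0‖) ≤ ‖step v E (m + n) 0 0‖ := by
  have h1 := abs_im_mul_norm_step_10_le v E m
  have h2 := abs_im_mul_norm_step_01_le (fun k => v (k + m)) E n
  rw [hE, abs_two] at *
  rw [step_add_00]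
  have h := norm_sub_norm_le (step (fun k => v (k + m)) E n 0 0 * step v E m 0 0)
    (-(step (fun k => v (k + m)) E n 0 1 * step v E m 1 0))
  rw [sub_neg_eq_add, norm_neg, norm_mul, norm_mul] at h
  -- Each off-diagonal factor is at most half of the first entry, so the second product is at most a
  -- quarter of the first; hence `3 / 4`.
  have := mul_le_mul h2 h1 (by positivity) (by positivity)
  linarith

open Polynomial in
lemma exists_polynomial_step : ∃ P Q : ℂ[X], ∀ z : ℂ, P.eval z = step v z n 0 0 ∧
    Q.eval z = step v z n 1 0 := by
  induction n with
  | zero => exact ⟨1, 0, fun z => by simp [step]⟩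
  | succ n ih =>
    obtain ⟨P, Q, h⟩ := ih
    refine ⟨(X - C (v n : ℂ)) * P - Q, P, fun z => ?_⟩
    rw [step_succ_00, step_succ_10, ← (h z).1, ← (h z).2]
    simp

/-- The first entry of the transfer matrix, as a function of the energy, factors over the reals. -/
lemma exists_step_eq_prod : ∃ (k : ℂ) (s : Multiset ℝ), k ≠ 0 ∧ ∀ z : ℂ, step v z n 0 0 =
    k * (s.map fun x : ℝ => z - x).prod := by
  obtain ⟨P, Q, h⟩ := exists_polynomial_step v n
  have hP : P ≠ 0 := by
    rintro rfl
    exact step_00_ne_zero v n (E := Complex.I) (by simp) (by rw [← (h _).1]; simp)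
  refine ⟨P.leadingCoeff, P.roots.map Complex.re, by simpa using hP, fun z => ?_⟩
  have hr : ∀ x ∈ P.roots, ((x.re : ℝ) : ℂ) = x := by
    intro x hx
    have hx0 : step v x n 0 0 = 0 := by rw [← (h x).1]; exact (Polynomial.mem_roots'.1 hx).2
    refine Complex.ext rfl ?_
    by_contra hne
    exact step_00_ne_zero v n (fun h0 => hne (by simp [h0])) hx0
  rw [← (h z).1, Multiset.map_map]
  conv_lhs => rw [(IsAlgClosed.splits P).eq_prod_roots]
  rw [Polynomial.eval_mul, Polynomial.eval_C, Polynomial.eval_multiset_prod, Multiset.map_map]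
  congr 2
  refine Multiset.map_congr rfl fun x hx => ?_
  simp [hr x hx]

/-- All roots are real, so a vertical move away from the real axis cannot decrease the distance to
any of them. -/
lemma norm_step_00_le_add (x : ℝ) {ε : ℝ} :
    ‖step v x n 0 0‖ ≤ ‖step v (x + ε * Complex.I) n 0 0‖ := by
  obtain ⟨k, s, -, h⟩ := exists_step_eq_prod v n
  have hn (t : Multiset ℝ) (z : ℂ) :
      ‖(t.map fun x : ℝ => z - x).prod‖ = (t.map fun x : ℝ => ‖z - x‖).prod := by
    induction t using Multiset.induction with
    | empty => simp
    | cons a t ih => simp [ih]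
  rw [h, h, norm_mul, norm_mul, hn, hn]
  gcongr
  refine Multiset.prod_map_le_prod_map₀ _ _ (fun _ _ => norm_nonneg _) fun a _ => ?_
  refine le_trans (le_of_eq ?_) (Complex.abs_re_le_norm _)
  rw [← Complex.ofReal_sub, Complex.norm_real]
  simp

lemma norm_step_01_le_add (x : ℝ) {ε : ℝ} :
    ‖step v x n 0 1‖ ≤ ‖step v (x + ε * Complex.I) n 0 1‖ := by
  cases n with
  | zero => simp [step]
  | succ n => simpa only [step_succ_01, norm_neg] using norm_step_00_le_add _ n x

open scoped Matrix.Norms.L2Operator in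
/-- The norm of the transfer matrix at a real energy is controlled by its first entry at an energy
vertically above. -/
lemma norm_step_le_add (x : ℝ) {ε : ℝ} (hε : 0 < ε) : ‖step v x n‖ ≤
    (2 + 2 / ε + 1 / ε ^ 2) * 4 * ‖step v (x + ε * Complex.I) n 0 0‖ := by
  have h := norm_step_le v n (E := x + ε * Complex.I) hε (by simp)
  have e := norm_entry_le (step v (x + ε * Complex.I) n)
  have h10 : ‖step v x n 1 0‖ ≤ ‖step v (x + ε * Complex.I) n 1 0‖ := by
    cases n with
    | zero => simp [step]
    | succ n => simpa only [step_succ_10] using norm_step_00_le_add v n x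
  have h11 : ‖step v x n 1 1‖ ≤ ‖step v (x + ε * Complex.I) n 1 1‖ := by
    cases n with
    | zero => simp [step]
    | succ n => simpa only [step_succ_11] using norm_step_01_le_add v n x
  have := norm_le_sum_entries (step v x n)
  have h00 := norm_step_00_le_add v n x (ε := ε)
  have h01 := norm_step_01_le_add v n x (ε := ε)
  -- The factor `4` counts the entries, each bounded by the norm at the shifted energy.
  linarith [e 0 0, e 0 1, e 1 0, e 1 1]

lemma multiset_prod_sub_ne_zero {s : Multiset ℝ} {z : ℂ} (hz : ∀ x ∈ s, z - x ≠ 0) :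
    (s.map fun x : ℝ => z - x).prod ≠ 0 := by
  refine Multiset.prod_ne_zero fun h => ?_
  obtain ⟨x, hx, h⟩ := Multiset.mem_map.1 h
  exact hz x hx h

lemma log_norm_multiset_prod (s : Multiset ℝ) {z : ℂ} (hz : ∀ x ∈ s, z - x ≠ 0) :
    Real.log ‖(s.map fun x : ℝ => z - x).prod‖ = (s.map fun x : ℝ => Real.log ‖z - x‖).sum := by
  induction s using Multiset.induction with
  | empty => simp
  | cons a t ih =>
    rw [Multiset.map_cons, Multiset.prod_cons, Multiset.map_cons, Multiset.sum_cons, norm_mul,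
      Real.log_mul (norm_ne_zero_iff.2 (hz a (by simp)))
        (norm_ne_zero_iff.2 (multiset_prod_sub_ne_zero fun x hx => hz x (by simp [hx]))),
      ih fun x hx => hz x (by simp [hx])]

end Step

lemma integral_multiset_sum_log_norm (s : Multiset ℝ) {y : ℝ} (hy : 0 ≤ y) :
    Integrable (fun E : ℝ => (s.map fun x : ℝ => Real.log ‖(E : ℂ) + y * Complex.I - x‖).sum)
      harmonicMeasure ∧
    ∫ E : ℝ, (s.map fun x : ℝ => Real.log ‖(E : ℂ) + y * Complex.I - x‖).sum ∂harmonicMeasure =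
      (s.map fun x : ℝ => Real.log ‖(2 + y) * Complex.I - x‖).sum := by
  induction s using Multiset.induction with
  | empty => simp
  | cons a t ih =>
    simp only [Multiset.map_cons, Multiset.sum_cons]
    refine ⟨(integrable_log_norm hy).add ih.1, ?_⟩
    rw [integral_add (integrable_log_norm hy) ih.1, integral_log_norm hy, ih.2]

open Complex in
/-- The Poisson integral formula for the logarithm of the first entry of the transfer matrix. -/
lemma integral_log_norm_step (v : ℕ → ℝ) (n : ℕ) {y : ℝ} (hy : 0 ≤ y) :
    Integrable (fun E : ℝ => Real.log ‖step v (E + y * I) n 0 0‖) harmonicMeasure ∧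
    ∫ E : ℝ, Real.log ‖step v (E + y * I) n 0 0‖ ∂harmonicMeasure =
      Real.log ‖step v ((2 + y) * I) n 0 0‖ := by
  obtain ⟨k, s, hk, h⟩ := exists_step_eq_prod v n
  have hs := integral_multiset_sum_log_norm s hy
  have hae : (fun E : ℝ => Real.log ‖step v (E + y * I) n 0 0‖) =ᵐ[harmonicMeasure]
      fun E : ℝ => Real.log ‖k‖ +
        (s.map fun x : ℝ => Real.log ‖(E : ℂ) + y * Complex.I - x‖).sum := by
    -- At height `0` the logarithm of the product and the sum of logarithms may differ at the roots,
    -- because of `Real.log 0 = 0`.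
    have hf : ∀ᵐ E : ℝ ∂harmonicMeasure, E ∉ s.toFinset := by
      refine compl_mem_ae_iff.2 ?_
      rw [harmonicMeasure_eq]
      exact withDensity_absolutelyContinuous _ _ (s.toFinset.finite_toSet.measure_zero _)
    filter_upwards [hf] with E hE
    have h0 : ∀ x ∈ s, (E : ℂ) + y * I - x ≠ 0 := by
      intro x hx h0
      have : E = x := by simpa [sub_eq_zero] using congrArg re h0
      exact hE (by simpa [this] using hx)
    rw [h, norm_mul, Real.log_mul (norm_ne_zero_iff.2 hk)
      (norm_ne_zero_iff.2 (multiset_prod_sub_ne_zero h0)), log_norm_multiset_prod s h0]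
  refine ⟨((integrable_const _).add hs.1).congr hae.symm, ?_⟩
  rw [integral_congr_ae hae, integral_add (integrable_const _) hs.1, hs.2]
  have h0 : ∀ x ∈ s, (2 + y) * I - x ≠ 0 := by
    intro x hx h0
    have := congrArg im h0
    simp at this
    linarith
  rw [h, norm_mul, Real.log_mul (norm_ne_zero_iff.2 hk)
    (norm_ne_zero_iff.2 (multiset_prod_sub_ne_zero h0)), log_norm_multiset_prod s h0]
  simp

end SchrodingerCocycle

/-! ### Logarithms of norms, and convergence to the Lyapunov exponent -/

namespace SchrodingerCocycle

open scoped Matrix.Norms.L2Operator in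
/-- The logarithm of the norm of the transfer matrix of a potential on the half-line. -/
noncomputable def logStep (v : ℕ → ℝ) (E : ℂ) (n : ℕ) : ℝ := Real.log ‖step v E n‖

section LogStep
open scoped Matrix.Norms.L2Operator

variable (v : ℕ → ℝ) (E : ℂ) (n m : ℕ)

lemma inv_two_le_norm_step : 2⁻¹ ≤ ‖step v E n‖ := by
  have := one_le_two_mul_norm_sq (det_step v E n)
  by_contra! h
  nlinarith [norm_nonneg (step v E n)]

lemma norm_step_pos : 0 < ‖step v E n‖ := lt_of_lt_of_le (by norm_num) (inv_two_le_norm_step v E n)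

lemma neg_log_two_le_logStep : -Real.log 2 ≤ logStep v E n := by
  rw [← Real.log_inv]
  exact Real.log_le_log (by norm_num) (inv_two_le_norm_step v E n)

lemma logStep_add_le : logStep v E (m + n) ≤ logStep v E m + logStep (fun k => v (k + m)) E n := by
  rw [logStep, logStep, logStep, step_add, add_comm, ← Real.log_mul (norm_step_pos _ _ _).ne'
    (norm_step_pos _ _ _).ne']
  refine Real.log_le_log ?_ (Matrix.l2_opNorm_mul _ _)
  rw [← step_add]
  exact norm_step_pos _ _ _

/-- Potentials carry the product topology: convergence along the orbit of a point is all that almost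
everywhere convergence supplies. -/
lemma continuous_step : Continuous fun p : (ℕ → ℝ) × ℂ => step p.1 p.2 n := by
  induction n with
  | zero => exact continuous_const
  | succ n ih =>
    refine Continuous.matrix_mul ?_ ih
    refine continuous_matrix fun i j => ?_
    fin_cases i <;> fin_cases j <;> simp <;> fun_prop

lemma continuous_logStep : Continuous fun p : (ℕ → ℝ) × ℂ => logStep p.1 p.2 n :=
  (continuous_norm.comp (continuous_step n)).log fun p => (norm_step_pos p.1 p.2 n).ne'

lemma measurable_logStep {α : Type*} [MeasurableSpace α] {w : α → ℕ → ℝ} {z : α → ℂ}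
    (hw : Measurable w) (hz : Measurable z) : Measurable fun a => logStep (w a) (z a) n := by
  have h := (continuous_logStep n).measurable
  have h2 : Measurable fun a => (w a, z a) := hw.prodMk hz
  simpa only [Function.comp_def] using h.comp h2

lemma tendsto_logStep {w : ℕ → ℕ → ℝ} {z : ℕ → ℂ} (hw : Tendsto w atTop (𝓝 v))
    (hz : Tendsto z atTop (𝓝 E)) :
    Tendsto (fun k => logStep (w k) (z k) n) atTop (𝓝 (logStep v E n)) := by
  have h := (continuous_logStep n).tendsto (v, E)
  have h2 : Tendsto (fun k => (w k, z k)) atTop (𝓝 (v, E)) := hw.prodMk_nhds hz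
  simpa only [Function.comp_def] using h.comp h2

variable {v} {r : ℝ}

lemma logStep_le (hv : ∀ k, |v k| ≤ r) : logStep v E n ≤ n * Real.log (‖E‖ + r + 2) := by
  have hr : 0 ≤ r := (abs_nonneg _).trans (hv 0)
  have h : ‖step v E n‖ ≤ (‖E‖ + r + 2) ^ n := by
    induction n with
    | zero => simp [step]
    | succ n ih =>
      rw [step, pow_succ']
      refine (Matrix.l2_opNorm_mul _ _).trans ?_
      gcongr
      refine (norm_le_sum_entries _).trans ?_
      have h1 := norm_sub_le E (v n)
      rw [Complex.norm_real, Real.norm_eq_abs] at h1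
      simp
      linarith [hv n]
  rw [← Real.log_pow]
  exact Real.log_le_log (norm_step_pos _ _ _) h

lemma abs_logStep_le (hv : ∀ k, |v k| ≤ r) :
    |logStep v E n| ≤ n * Real.log (‖E‖ + r + 2) + Real.log 2 := by
  have hr : 0 ≤ r := (abs_nonneg _).trans (hv 0)
  have h1 := logStep_le E n hv
  have h2 := neg_log_two_le_logStep v E n
  have h3 : 0 < Real.log 2 := Real.log_pos one_lt_two
  have h4 : 0 ≤ n * Real.log (‖E‖ + r + 2) :=
    mul_nonneg n.cast_nonneg (Real.log_nonneg (by linarith [norm_nonneg E]))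
  rw [abs_le]
  constructor <;> linarith

variable (v) {E}

lemma log_norm_step_00_le (h : step v E n 0 0 ≠ 0) : Real.log ‖step v E n 0 0‖ ≤ logStep v E n :=
  Real.log_le_log (norm_pos_iff.2 h) (norm_entry_le _ 0 0)

lemma logStep_le_log_norm_step_00 {y : ℝ} (hy : 0 < y) (hE : E.im = y) :
    logStep v E n ≤ Real.log (2 + 2 / y + 1 / y ^ 2) + Real.log ‖step v E n 0 0‖ := by
  have h0 : step v E n 0 0 ≠ 0 := step_00_ne_zero v n (by rw [hE]; exact hy.ne')
  rw [← Real.log_mul (by positivity) (norm_ne_zero_iff.2 h0)]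
  exact Real.log_le_log (norm_step_pos _ _ _) (norm_step_le v n hy hE)

lemma logStep_real_le (x : ℝ) {ε : ℝ} (hε : 0 < ε) :
    logStep v x n ≤ Real.log ((2 + 2 / ε + 1 / ε ^ 2) * 4) +
      Real.log ‖step v (x + ε * Complex.I) n 0 0‖ := by
  have h0 : step v (x + ε * Complex.I) n 0 0 ≠ 0 := step_00_ne_zero v n (by simpa using hε.ne')
  rw [← Real.log_mul (by positivity) (norm_ne_zero_iff.2 h0)]
  exact Real.log_le_log (norm_step_pos _ _ _) (norm_step_le_add v n x hε)

/-- Superadditivity, up to a constant, of the logarithm of the norm at height `2`. -/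
lemma logStep_add_ge (hE : E.im = 2) : logStep v E m + logStep (fun k => v (k + m)) E n -
    (2 * Real.log 4 + Real.log 2) ≤ logStep v E (m + n) := by
  have hne : E.im ≠ 0 := by rw [hE]; norm_num
  have h0 := fun v n => step_00_ne_zero v n hne
  have hp := fun v n => norm_pos_iff.2 (h0 v n)
  -- The constant of `norm_step_le` at `y = 2` is `13 / 4`, rounded up to `4`.
  have h4 : ∀ v n, logStep v E n ≤ Real.log 4 + Real.log ‖step v E n 0 0‖ := by
    intro v n
    refine (logStep_le_log_norm_step_00 v n two_pos hE).trans ?_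
    gcongr
    norm_num
  have h := Real.log_le_log (by have := hp v m; have := hp (fun k => v (k + m)) n; positivity)
    (norm_step_mul_le v n m hE)
  rw [Real.log_mul (by norm_num) (mul_pos (hp _ _) (hp _ _)).ne',
    Real.log_mul (hp _ _).ne' (hp _ _).ne'] at h
  have h2 : -Real.log 2 ≤ Real.log (3 / 4) := by
    rw [← Real.log_inv]
    exact Real.log_le_log (by norm_num) (by norm_num)
  linarith [h4 v m, h4 (fun k => v (k + m)) n, log_norm_step_00_le v (m + n) (h0 _ _)]

end LogStep

section Ergodic
variable {Ω : Type*} [MeasurableSpace Ω] {T : Ω → Ω} {μ : Measure Ω} [IsProbabilityMeasure μ]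
  {f : Ω → ℝ} {r : ℝ}

omit [MeasurableSpace Ω] in
lemma logNorm_eq_logStep (T : Ω → Ω) (f : Ω → ℝ) (E : ℂ) (n : ℕ) (ω : Ω) :
    logNorm T f E n ω = logStep (fun k => f (T^[k] ω)) E n := by
  rw [logNorm, logStep, iterTransfer_eq_step]

lemma measurable_logNorm_uncurry (hT : Measurable T) (hf : Measurable f) (n : ℕ) :
    Measurable fun p : ℂ × Ω => logNorm T f p.1 n p.2 := by
  simp only [logNorm_eq_logStep]
  exact measurable_logStep n (measurable_pi_lambda _ fun k =>
    hf.comp ((hT.iterate k).comp measurable_snd)) measurable_fst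

lemma measurable_logNorm (hT : Measurable T) (hf : Measurable f) (E : ℂ) (n : ℕ) :
    Measurable (logNorm T f E n) := by
  have h := (measurable_logNorm_uncurry hT hf n).comp (measurable_prodMk_left (x := E))
  simpa only [Function.comp_def] using h

omit [MeasurableSpace Ω] in
lemma abs_logNorm_le (hfr : ∀ ω, |f ω| ≤ r) (E : ℂ) (n : ℕ) (ω : Ω) :
    |logNorm T f E n ω| ≤ n * Real.log (‖E‖ + r + 2) + Real.log 2 := by
  rw [logNorm_eq_logStep]
  exact abs_logStep_le E n fun k => hfr _

lemma integrable_logNorm (hT : Measurable T) (hf : Measurable f) (hfr : ∀ ω, |f ω| ≤ r)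
    (E : ℂ) (n : ℕ) : Integrable (logNorm T f E n) μ :=
  .of_bound (measurable_logNorm hT hf E n).aestronglyMeasurable
    _ (ae_of_all _ fun ω => (abs_logNorm_le hfr E n ω))

omit [IsProbabilityMeasure μ] in
lemma integral_logNorm_iterate (hT : MeasurePreserving T μ μ) (hf : Measurable f) (E : ℂ)
    (n m : ℕ) : ∫ ω, logStep (fun k => f (T^[k + m] ω)) E n ∂μ = ∫ ω, logNorm T f E n ω ∂μ := by
  conv_rhs => rw [← (hT.iterate m).map_eq]
  rw [integral_map (hT.iterate m).measurable.aemeasurable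
    (measurable_logNorm hT.measurable hf E n).aestronglyMeasurable]
  simp only [logNorm_eq_logStep, Function.iterate_add_apply]

lemma integrable_logNorm_iterate (hT : Measurable T) (hf : Measurable f) (hfr : ∀ ω, |f ω| ≤ r)
    (E : ℂ) (n m : ℕ) : Integrable (fun ω => logStep (fun k => f (T^[k + m] ω)) E n) μ := by
  refine .of_bound (Measurable.aestronglyMeasurable ?_) _
    (ae_of_all _ fun ω => (abs_logStep_le E n fun k => hfr (T^[k + m] ω)))
  exact measurable_logStep n (measurable_pi_lambda _ fun k => hf.comp (hT.iterate _))
    measurable_const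

lemma subadditive_integral_logNorm (hT : MeasurePreserving T μ μ) (hf : Measurable f)
    (hfr : ∀ ω, |f ω| ≤ r) (E : ℂ) : Subadditive fun n => ∫ ω, logNorm T f E n ω ∂μ := by
  intro m n
  beta_reduce
  rw [← integral_logNorm_iterate hT hf E n m, ← integral_add (integrable_logNorm hT.measurable hf hfr E m)
    (integrable_logNorm_iterate hT.measurable hf hfr E n m)]
  refine integral_mono (integrable_logNorm hT.measurable hf hfr E _)
    ((integrable_logNorm hT.measurable hf hfr E m).add
      (integrable_logNorm_iterate hT.measurable hf hfr E n m)) fun ω => ?_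
  simp only [logNorm_eq_logStep]
  exact logStep_add_le _ E n m

omit [IsProbabilityMeasure μ] in
lemma lyapunovSeq_eq_div (E : ℂ) (n : ℕ) :
    lyapunovSeq T μ f E n = (∫ ω, logNorm T f E n ω ∂μ) / n := by
  rw [lyapunovSeq]; ring

lemma neg_log_two_le_integral (hT : Measurable T) (hf : Measurable f) (hfr : ∀ ω, |f ω| ≤ r)
    (E : ℂ) (n : ℕ) : -Real.log 2 ≤ ∫ ω, logNorm T f E n ω ∂μ := by
  have := integral_mono (μ := μ) (integrable_const (-Real.log 2))
    (integrable_logNorm hT hf hfr E n)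
    (fun ω => by simpa only [logNorm_eq_logStep] using neg_log_two_le_logStep _ E n)
  simpa using this

lemma neg_log_two_div_le_lyapunovSeq (hT : Measurable T) (hf : Measurable f) (hfr : ∀ ω, |f ω| ≤ r)
    (E : ℂ) (n : ℕ) : -Real.log 2 / n ≤ lyapunovSeq T μ f E n := by
  rw [lyapunovSeq_eq_div]
  gcongr
  exact neg_log_two_le_integral hT hf hfr E n

lemma neg_log_two_le_lyapunovSeq (hT : Measurable T) (hf : Measurable f) (hfr : ∀ ω, |f ω| ≤ r)
    (E : ℂ) (n : ℕ) : -Real.log 2 ≤ lyapunovSeq T μ f E n := by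
  refine le_trans ?_ (neg_log_two_div_le_lyapunovSeq hT hf hfr E n)
  have h2 : 0 < Real.log 2 := Real.log_pos one_lt_two
  rcases n.eq_zero_or_pos with rfl | hn
  · simp [h2.le]
  · rw [neg_div, neg_le_neg_iff]
    exact div_le_self h2.le (by exact_mod_cast hn)

lemma lyapunovSeq_le (hT : Measurable T) (hf : Measurable f) (hfr : ∀ ω, |f ω| ≤ r)
    (hr : 0 ≤ r) (E : ℂ) (n : ℕ) : lyapunovSeq T μ f E n ≤ Real.log (‖E‖ + r + 2) := by
  rw [lyapunovSeq_eq_div]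
  refine div_le_of_le_mul₀ n.cast_nonneg (Real.log_nonneg (by linarith [norm_nonneg E])) ?_
  have := integral_mono (μ := μ) (integrable_logNorm hT hf hfr E n)
    (integrable_const (n * Real.log (‖E‖ + r + 2)))
    (fun ω => by simpa only [logNorm_eq_logStep] using logStep_le E n fun k => hfr (T^[k] ω))
  simpa [mul_comm] using this

lemma bddBelow_lyapunovSeq (hT : Measurable T) (hf : Measurable f)
    (hfr : ∀ ω, |f ω| ≤ r) (E : ℂ) :
    BddBelow (Set.range fun n : ℕ => (∫ ω, logNorm T f E n ω ∂μ) / n) := by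
  refine ⟨-Real.log 2, ?_⟩
  rintro _ ⟨n, rfl⟩
  simpa only [lyapunovSeq_eq_div] using neg_log_two_le_lyapunovSeq (μ := μ) hT hf hfr E n

lemma tendsto_lyapunovSeq (hT : MeasurePreserving T μ μ) (hf : Measurable f)
    (hfr : ∀ ω, |f ω| ≤ r) (E : ℂ) :
    Tendsto (lyapunovSeq T μ f E) atTop (𝓝 (lyapunov T μ f E)) := by
  have h := (subadditive_integral_logNorm hT hf hfr E).tendsto_lim
    (bddBelow_lyapunovSeq hT.measurable hf hfr E)
  simp only [← lyapunovSeq_eq_div] at h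
  rw [lyapunov, h.limUnder_eq]
  exact h

/-- By Fekete's lemma the limit is an infimum; this is the source of upper semicontinuity, in the
energy and in the potential. -/
lemma lyapunov_le_lyapunovSeq (hT : MeasurePreserving T μ μ) (hf : Measurable f)
    (hfr : ∀ ω, |f ω| ≤ r) (E : ℂ) {n : ℕ} (hn : n ≠ 0) :
    lyapunov T μ f E ≤ lyapunovSeq T μ f E n := by
  have hb := bddBelow_lyapunovSeq (μ := μ) hT.measurable hf hfr E
  have hs := subadditive_integral_logNorm hT hf hfr E
  have h := hs.tendsto_lim hb
  simp only [← lyapunovSeq_eq_div] at h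
  rw [tendsto_nhds_unique (tendsto_lyapunovSeq hT hf hfr E) h, lyapunovSeq_eq_div]
  exact hs.lim_le_div hb hn

lemma lyapunov_nonneg (hT : MeasurePreserving T μ μ) (hf : Measurable f)
    (hfr : ∀ ω, |f ω| ≤ r) (E : ℂ) : 0 ≤ lyapunov T μ f E :=
  le_of_tendsto_of_tendsto' (tendsto_const_div_atTop_nhds_zero_nat _)
    (tendsto_lyapunovSeq hT hf hfr E) (neg_log_two_div_le_lyapunovSeq hT.measurable hf hfr E)

lemma lyapunov_le (hT : MeasurePreserving T μ μ) (hf : Measurable f)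
    (hfr : ∀ ω, |f ω| ≤ r) (hr : 0 ≤ r) (E : ℂ) : lyapunov T μ f E ≤ Real.log (‖E‖ + r + 2) :=
  le_of_tendsto' (tendsto_lyapunovSeq hT hf hfr E) (lyapunovSeq_le hT.measurable hf hfr hr E)

/-- At the energies of height `2` the averages converge to the Lyapunov exponent uniformly in the
potential. -/
lemma lyapunovSeq_sub_le_lyapunov (hT : MeasurePreserving T μ μ) (hf : Measurable f)
    (hfr : ∀ ω, |f ω| ≤ r) {E : ℂ} (hE : E.im = 2) {n : ℕ} (hn : n ≠ 0) :
    lyapunovSeq T μ f E n - (2 * Real.log 4 + Real.log 2) / n ≤ lyapunov T μ f E := by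
  set C := 2 * Real.log 4 + Real.log 2 with hC
  -- Superadditivity with defect `C` is exact subadditivity of `C` minus the integrals, so Fekete's
  -- lemma also bounds the averages from above.
  have hs : Subadditive fun n => C - ∫ ω, logNorm T f E n ω ∂μ := by
    intro m n
    have : ∫ ω, logNorm T f E m ω ∂μ + ∫ ω, logNorm T f E n ω ∂μ - C ≤
        ∫ ω, logNorm T f E (m + n) ω ∂μ := by
      have hi := (integrable_logNorm (μ := μ) hT.measurable hf hfr E m).add
        (integrable_logNorm_iterate hT.measurable hf hfr E n m)
      have h1 : C = ∫ _, C ∂μ := by simp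
      rw [← integral_logNorm_iterate hT hf E n m, ← integral_add
        (integrable_logNorm hT.measurable hf hfr E m)
        (integrable_logNorm_iterate hT.measurable hf hfr E n m)]
      conv_lhs => rw [h1]
      rw [← integral_sub (by exact hi) (integrable_const _)]
      refine integral_mono (hi.sub (integrable_const _))
        (integrable_logNorm hT.measurable hf hfr E _) fun ω => ?_
      simp only [logNorm_eq_logStep]
      exact logStep_add_ge _ n m hE
    dsimp only
    linarith
  have hlim : Tendsto (fun n : ℕ => (C - ∫ ω, logNorm T f E n ω ∂μ) / n) atTop
      (𝓝 (0 - lyapunov T μ f E)) := by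
    simp only [sub_div, ← lyapunovSeq_eq_div]
    exact (tendsto_const_div_atTop_nhds_zero_nat _).sub (tendsto_lyapunovSeq hT hf hfr E)
  have hb := hlim.bddBelow_range
  have h := hs.lim_le_div hb hn
  rw [tendsto_nhds_unique (hs.tendsto_lim hb) hlim, sub_div, ← lyapunovSeq_eq_div] at h
  linarith

omit [IsProbabilityMeasure μ] in
lemma ae_tendsto_iterate (hT : MeasurePreserving T μ μ) {g : ℕ → Ω → ℝ}
    (hg : ∀ᵐ ω ∂μ, Tendsto (fun k => g k ω) atTop (𝓝 (f ω))) :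
    ∀ᵐ ω ∂μ, ∀ j, Tendsto (fun k => g k (T^[j] ω)) atTop (𝓝 (f (T^[j] ω))) :=
  ae_all_iff.2 fun j => (hT.iterate j).quasiMeasurePreserving.ae hg

lemma tendsto_lyapunovSeq_of_ae (hT : MeasurePreserving T μ μ) {g : ℕ → Ω → ℝ}
    (hgm : ∀ k, Measurable (g k)) (hgr : ∀ k ω, |g k ω| ≤ r)
    (hg : ∀ᵐ ω ∂μ, Tendsto (fun k => g k ω) atTop (𝓝 (f ω))) {z : ℕ → ℂ} {E : ℂ}
    (hz : Tendsto z atTop (𝓝 E)) (n : ℕ) :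
    Tendsto (fun k => lyapunovSeq T μ (g k) (z k) n) atTop (𝓝 (lyapunovSeq T μ f E n)) := by
  refine Tendsto.const_mul _ ?_
  obtain ⟨R, hR⟩ := (Metric.isBounded_range_of_tendsto z hz).exists_norm_le
  refine tendsto_integral_of_dominated_convergence
    (fun _ => n * Real.log (R + r + 2) + Real.log 2)
    (fun k => (measurable_logNorm hT.measurable (hgm k) (z k) n).aestronglyMeasurable) (integrable_const _)
    (fun k => ae_of_all _ fun ω => ?_) ?_
  · refine (abs_logNorm_le (hgr k) (z k) n ω).trans ?_
    have : 0 ≤ r := (abs_nonneg _).trans (hgr k ω)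
    have := hR _ (Set.mem_range_self k)
    gcongr
  · filter_upwards [ae_tendsto_iterate hT hg] with ω hω
    simp only [logNorm_eq_logStep]
    exact tendsto_logStep _ _ n (tendsto_pi_nhds.2 hω) hz

lemma continuous_lyapunovSeq (hT : MeasurePreserving T μ μ) (hf : Measurable f)
    (hfr : ∀ ω, |f ω| ≤ r) (n : ℕ) : Continuous fun E => lyapunovSeq T μ f E n :=
  continuous_iff_seqContinuous.2 fun _ _ hz => tendsto_lyapunovSeq_of_ae hT (fun _ => hf)
    (fun _ => hfr) (ae_of_all _ fun _ => tendsto_const_nhds) hz n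

lemma measurable_lyapunov (hT : MeasurePreserving T μ μ) (hf : Measurable f)
    (hfr : ∀ ω, |f ω| ≤ r) : Measurable (lyapunov T μ f) :=
  measurable_of_tendsto_metrizable (fun n => (continuous_lyapunovSeq hT hf hfr n).measurable)
    (tendsto_pi_nhds.2 fun E => tendsto_lyapunovSeq hT hf hfr E)

/-- At height `2` the Lyapunov exponent depends continuously on the potential. -/
lemma tendsto_lyapunov_of_ae (hT : MeasurePreserving T μ μ) {g : ℕ → Ω → ℝ}
    (hf : Measurable f) (hfr : ∀ ω, |f ω| ≤ r)
    (hgm : ∀ k, Measurable (g k)) (hgr : ∀ k ω, |g k ω| ≤ r)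
    (hg : ∀ᵐ ω ∂μ, Tendsto (fun k => g k ω) atTop (𝓝 (f ω))) {E : ℂ} (hE : E.im = 2) :
    Tendsto (fun k => lyapunov T μ (g k) E) atTop (𝓝 (lyapunov T μ f E)) := by
  set C := 2 * Real.log 4 + Real.log 2 with hC
  have hC0 : Tendsto (fun n : ℕ => C / n) atTop (𝓝 0) := tendsto_const_div_atTop_nhds_zero_nat _
  have hlim := tendsto_lyapunovSeq_of_ae hT hgm hgr hg (tendsto_const_nhds (x := E))
  have hlim' := tendsto_lyapunovSeq hT hf hfr E
  rw [Metric.tendsto_nhds]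
  intro ε hε
  obtain ⟨n, hn1, hn0⟩ := ((hC0.eventually (gt_mem_nhds (show 0 < ε / 3 by positivity))).and
    (eventually_ne_atTop 0)).exists
  filter_upwards [Metric.tendsto_nhds.1 (hlim n) (ε / 3) (by positivity)] with k hk
  have h1 := lyapunov_le_lyapunovSeq hT hf hfr E hn0
  have h2 := lyapunov_le_lyapunovSeq hT (hgm k) (hgr k) E hn0
  have h3 := lyapunovSeq_sub_le_lyapunov hT hf hfr hE hn0
  have h4 := lyapunovSeq_sub_le_lyapunov hT (hgm k) (hgr k) hE hn0
  rw [Real.dist_eq, abs_lt] at *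
  constructor <;> linarith

end Ergodic
end SchrodingerCocycle

/-! ### Poisson formula and mean continuity of the exponent -/

namespace SchrodingerCocycle

/-- A logarithmically growing majorant, on the real line, of the Lyapunov exponents of the
potentials bounded by `r`. -/
noncomputable def growth (r E : ℝ) : ℝ :=
  Real.log (r + 3) + Real.log ‖(E : ℂ) + (1 : ℝ) * Complex.I - (0 : ℝ)‖

/-- The majorant is written with the potential of a point at distance `1` from the axis so that
`integrable_log_norm` applies. -/
lemma integrable_growth (r : ℝ) : Integrable (growth r) harmonicMeasure :=
  (integrable_const _).add (integrable_log_norm zero_le_one)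

lemma log_norm_add_le_growth {r : ℝ} (hr : 0 ≤ r) (E : ℝ) :
    Real.log (‖(E : ℂ)‖ + r + 2) ≤ growth r E := by
  have h1 : |E| ≤ ‖(E : ℂ) + (1 : ℝ) * Complex.I - (0 : ℝ)‖ := by
    simpa using Complex.abs_re_le_norm ((E : ℂ) + (1 : ℝ) * Complex.I - (0 : ℝ))
  have h2 : 1 ≤ ‖(E : ℂ) + (1 : ℝ) * Complex.I - (0 : ℝ)‖ := by
    simpa using Complex.abs_im_le_norm ((E : ℂ) + (1 : ℝ) * Complex.I - (0 : ℝ))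
  rw [growth, ← Real.log_mul (by positivity) (by positivity), Complex.norm_real, Real.norm_eq_abs]
  refine Real.log_le_log (by positivity) ?_
  nlinarith

lemma log_two_le_growth {r : ℝ} (hr : 0 ≤ r) (E : ℝ) : Real.log 2 ≤ growth r E :=
  (Real.log_le_log two_pos (by linarith [norm_nonneg (E : ℂ)])).trans (log_norm_add_le_growth hr E)

section Step
variable (v : ℕ → ℝ) (n : ℕ) {r : ℝ}

/-- The slack `log 2` absorbs the default `Real.log 0 = 0` at a root, where the log-norm may be
negative. -/
lemma log_norm_step_00_le_add_log_two (E : ℂ) :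
    Real.log ‖step v E n 0 0‖ ≤ logStep v E n + Real.log 2 := by
  have h2 : 0 < Real.log 2 := Real.log_pos one_lt_two
  by_cases h : step v E n 0 0 = 0
  · rw [h, norm_zero, Real.log_zero]
    linarith [neg_log_two_le_logStep v E n]
  · linarith [log_norm_step_00_le v n h]

variable {v}

lemma abs_logStep_le_growth (hr : 0 ≤ r) (hv : ∀ k, |v k| ≤ r) (E : ℝ) :
    |logStep v E n| ≤ n * growth r E + Real.log 2 := by
  refine (abs_logStep_le E n hv).trans ?_
  have := log_norm_add_le_growth hr E
  gcongr

lemma integrable_logStep (hr : 0 ≤ r) (hv : ∀ k, |v k| ≤ r) :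
    Integrable (fun E : ℝ => logStep v E n) harmonicMeasure := by
  refine (((integrable_growth r).const_mul (n : ℝ)).add (integrable_const (Real.log 2))).mono'
    (measurable_logStep n measurable_const Complex.measurable_ofReal).aestronglyMeasurable
    (ae_of_all _ fun E => abs_logStep_le_growth n hr hv E)

/-- The Poisson formula at height `0`: on the axis the first entry is at most the norm, and at `2i`
the two are comparable. -/
lemma logStep_two_I_le_integral (hr : 0 ≤ r) (hv : ∀ k, |v k| ≤ r) :
    logStep v (2 * Complex.I) n - (Real.log 4 + Real.log 2) ≤
      ∫ E : ℝ, logStep v E n ∂harmonicMeasure := by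
  have h := integral_log_norm_step v n le_rfl
  simp only [Complex.ofReal_zero, zero_mul, add_zero] at h
  have h1 := integral_mono h.1 ((integrable_logStep n hr hv).add (integrable_const (Real.log 2)))
    fun E => log_norm_step_00_le_add_log_two v n E
  rw [integral_add' (integrable_logStep n hr hv) (integrable_const _), h.2] at h1
  have h2 := logStep_le_log_norm_step_00 v n two_pos (E := 2 * Complex.I) (by simp)
  have h3 : Real.log (2 + 2 / 2 + 1 / 2 ^ 2) ≤ Real.log 4 :=
    Real.log_le_log (by norm_num) (by norm_num)
  simp only [integral_const, probReal_univ, one_smul] at h1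
  linarith

/-- On the axis the first entry may vanish and cannot bound the norm, so the formula is used at
height `ε`, at the price of a constant depending on `ε` but not on `n`. -/
lemma integral_logStep_le (hr : 0 ≤ r) (hv : ∀ k, |v k| ≤ r) {ε : ℝ} (hε : 0 < ε) :
    ∫ E : ℝ, logStep v E n ∂harmonicMeasure ≤
      Real.log ((2 + 2 / ε + 1 / ε ^ 2) * 4) + logStep v ((2 + ε) * Complex.I) n := by
  have h := integral_log_norm_step v n hε.le
  have h1 := integral_mono (integrable_logStep n hr hv)
    ((integrable_const (Real.log ((2 + 2 / ε + 1 / ε ^ 2) * 4))).add h.1)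
    fun E => logStep_real_le v n E hε
  rw [integral_add' (integrable_const _) h.1, h.2] at h1
  have h2 := log_norm_step_00_le v n (E := (2 + ε) * Complex.I) (step_00_ne_zero v n (by
    simp; linarith))
  simp only [integral_const, probReal_univ, one_smul] at h1
  linarith

/-- Such energies preserve the cone where the upper entry of the first column dominates the lower
one, and each step expands the upper entry by at least `|E| - r - 1`. -/
lemma le_logStep_of_lt_abs (hv : ∀ k, |v k| ≤ r) {E : ℝ} (hE : r + 2 ≤ |E|) :
    n * Real.log (|E| - r - 1) ≤ logStep v E n := by
  have h : ‖step v E n 1 0‖ ≤ ‖step v E n 0 0‖ ∧ (|E| - r - 1) ^ n ≤ ‖step v E n 0 0‖ := by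
    induction n with
    | zero => simp [step]
    | succ n ih =>
      have h1 : |E| - r ≤ ‖(E : ℂ) - v n‖ := by
        rw [← Complex.ofReal_sub, Complex.norm_real, Real.norm_eq_abs]
        linarith [abs_sub_abs_le_abs_sub E (v n), hv n]
      have h2 := norm_sub_norm_le ((E - v n) * step v E n 0 0) (step v E n 1 0)
      rw [← step_succ_00, norm_mul] at h2
      have h3 := mul_le_mul_of_nonneg_right h1 (norm_nonneg (step v E n 0 0))
      have h4 : (|E| - r - 1) * ‖step v E n 0 0‖ ≤ ‖step v E (n + 1) 0 0‖ := by linarith [ih.1]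
      refine ⟨?_, ?_⟩
      · rw [step_succ_10]
        nlinarith [norm_nonneg (step v E n 0 0)]
      · rw [pow_succ']
        exact (mul_le_mul_of_nonneg_left ih.2 (by linarith)).trans h4
  have hp : 0 < (|E| - r - 1) ^ n := pow_pos (by linarith) n
  rw [← Real.log_pow]
  exact (Real.log_le_log hp h.2).trans
    (log_norm_step_00_le v n (norm_pos_iff.1 (hp.trans_le h.2)))

end Step

section Ergodic
variable {Ω : Type*} [MeasurableSpace Ω] {T : Ω → Ω} {μ : Measure Ω} [IsProbabilityMeasure μ]
  {f : Ω → ℝ} {r : ℝ}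

lemma abs_lyapunovSeq_le_growth (hT : Measurable T) (hf : Measurable f) (hfr : ∀ ω, |f ω| ≤ r)
    (hr : 0 ≤ r) (E : ℝ) (n : ℕ) : |lyapunovSeq T μ f E n| ≤ growth r E := by
  rw [abs_le]
  exact ⟨by linarith [neg_log_two_le_lyapunovSeq (μ := μ) hT hf hfr E n, log_two_le_growth hr E],
    (lyapunovSeq_le hT hf hfr hr E n).trans (log_norm_add_le_growth hr E)⟩

lemma lyapunov_le_growth (hT : MeasurePreserving T μ μ) (hf : Measurable f)
    (hfr : ∀ ω, |f ω| ≤ r) (hr : 0 ≤ r) (E : ℝ) : lyapunov T μ f E ≤ growth r E :=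
  (lyapunov_le hT hf hfr hr E).trans (log_norm_add_le_growth hr E)

lemma integrable_lyapunov (hT : MeasurePreserving T μ μ) (hf : Measurable f)
    (hfr : ∀ ω, |f ω| ≤ r) (hr : 0 ≤ r) :
    Integrable (fun E : ℝ => lyapunov T μ f E) harmonicMeasure := by
  refine (integrable_growth r).mono' ((measurable_lyapunov hT hf hfr).comp
    Complex.measurable_ofReal).aestronglyMeasurable (ae_of_all _ fun E => ?_)
  rw [Real.norm_of_nonneg (lyapunov_nonneg hT hf hfr E)]
  exact lyapunov_le_growth hT hf hfr hr E

lemma tendsto_integral_lyapunovSeq (hT : MeasurePreserving T μ μ) (hf : Measurable f)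
    (hfr : ∀ ω, |f ω| ≤ r) (hr : 0 ≤ r) :
    Tendsto (fun n => ∫ E : ℝ, lyapunovSeq T μ f E n ∂harmonicMeasure) atTop
      (𝓝 (∫ E : ℝ, lyapunov T μ f E ∂harmonicMeasure)) :=
  tendsto_integral_of_dominated_convergence (growth r)
    (fun n => ((continuous_lyapunovSeq hT hf hfr n).measurable.comp
      Complex.measurable_ofReal).aestronglyMeasurable) (integrable_growth r)
    (fun n => ae_of_all _ fun E => abs_lyapunovSeq_le_growth hT.measurable hf hfr hr E n)
    (ae_of_all _ fun E => tendsto_lyapunovSeq hT hf hfr E)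

lemma integrable_logNorm_prod (hT : Measurable T) (hf : Measurable f)
    (hfr : ∀ ω, |f ω| ≤ r) (hr : 0 ≤ r) (n : ℕ) :
    Integrable (fun p : ℝ × Ω => logNorm T f p.1 n p.2) (harmonicMeasure.prod μ) := by
  have hb := (((integrable_growth r).const_mul (n : ℝ)).add
    (integrable_const (Real.log 2))).comp_fst μ
  have hm : Measurable fun p : ℝ × Ω => logNorm T f p.1 n p.2 := by
    have h := (measurable_logNorm_uncurry hT hf n).comp
      ((Complex.measurable_ofReal.comp (measurable_fst (α := ℝ) (β := Ω))).prodMk measurable_snd)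
    simpa only [Function.comp_def] using h
  refine hb.mono' hm.aestronglyMeasurable (ae_of_all _ fun p => ?_)
  rw [logNorm_eq_logStep]
  exact abs_logStep_le_growth n hr (fun k => hfr _) p.1

lemma integral_lyapunovSeq_eq (hT : Measurable T) (hf : Measurable f)
    (hfr : ∀ ω, |f ω| ≤ r) (hr : 0 ≤ r) (n : ℕ) :
    ∫ E : ℝ, lyapunovSeq T μ f E n ∂harmonicMeasure =
      (∫ ω, ∫ E : ℝ, logNorm T f E n ω ∂harmonicMeasure ∂μ) / n := by
  rw [← integral_integral_swap (f := fun (E : ℝ) ω => logNorm T f E n ω)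
    (integrable_logNorm_prod hT hf hfr hr n), ← integral_div]
  simp only [lyapunovSeq_eq_div]

/-- The Lyapunov exponent of a real potential is the Poisson integral of its restriction to the
real line. -/
theorem integral_lyapunov (hT : MeasurePreserving T μ μ) (hf : Measurable f)
    (hfr : ∀ ω, |f ω| ≤ r) (hr : 0 ≤ r) :
    ∫ E : ℝ, lyapunov T μ f E ∂harmonicMeasure = lyapunov T μ f (2 * Complex.I) := by
  have hlim := tendsto_integral_lyapunovSeq hT hf hfr hr
  have hint : ∀ n, Integrable (fun ω => ∫ E : ℝ, logNorm T f E n ω ∂harmonicMeasure) μ :=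
    fun n => (integrable_logNorm_prod hT.measurable hf hfr hr n).integral_prod_right
  have hc := fun C : ℝ => tendsto_const_div_atTop_nhds_zero_nat C
  refine le_antisymm ?_ ?_
  -- With `ε` fixed, the comparison constant vanishes after division by `n`.
  · have h1 : ∀ ε : ℝ, 0 < ε → ∫ E : ℝ, lyapunov T μ f E ∂harmonicMeasure ≤
        lyapunov T μ f ((2 + ε) * Complex.I) := by
      intro ε hε
      set C := Real.log ((2 + 2 / ε + 1 / ε ^ 2) * 4)
      have h2 := (hc C).add (tendsto_lyapunovSeq hT hf hfr ((2 + ε) * Complex.I))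
      rw [zero_add] at h2
      refine le_of_tendsto_of_tendsto' hlim h2 fun n => ?_
      rw [integral_lyapunovSeq_eq hT.measurable hf hfr hr, lyapunovSeq_eq_div, ← add_div]
      gcongr
      have h3 := integral_mono (hint n) ((integrable_const C).add
        (integrable_logNorm (μ := μ) hT.measurable hf hfr ((2 + ε) * Complex.I) n)) fun ω => by
          simp only [logNorm_eq_logStep, Pi.add_apply]
          exact integral_logStep_le n hr (fun k => hfr _) hε
      rw [integral_add' (integrable_const _) (integrable_logNorm hT.measurable hf hfr _ n)] at h3
      simpa using h3
    -- To let `ε` tend to `0`, the exponent at height `2 + ε` is replaced by a finite average, which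
    -- bounds it above and is continuous in the energy.
    refine ge_of_tendsto (tendsto_lyapunovSeq hT hf hfr (2 * Complex.I)) ?_
    filter_upwards [eventually_ne_atTop 0] with n hn
    have h4 : Tendsto (fun k : ℕ => lyapunovSeq T μ f ((2 + (1 / ((k : ℝ) + 1) : ℝ)) * Complex.I) n)
        atTop (𝓝 (lyapunovSeq T μ f (2 * Complex.I) n)) := by
      refine ((continuous_lyapunovSeq hT hf hfr n).tendsto _).comp ?_
      have h5 : Tendsto (fun k : ℕ => ((1 / ((k : ℝ) + 1) : ℝ) : ℂ)) atTop (𝓝 ((0 : ℝ) : ℂ)) :=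
        (Complex.continuous_ofReal.tendsto 0).comp tendsto_one_div_add_atTop_nhds_zero_nat
      have h6 := (h5.const_add 2).mul_const Complex.I
      simpa using h6
    exact ge_of_tendsto' h4 fun k => (h1 _ Nat.one_div_pos_of_nat).trans
      (lyapunov_le_lyapunovSeq hT hf hfr _ hn)
  · have h2 := (tendsto_lyapunovSeq hT hf hfr (2 * Complex.I)).sub (hc (Real.log 4 + Real.log 2))
    rw [sub_zero] at h2
    refine le_of_tendsto_of_tendsto' h2 hlim fun n => ?_
    rw [integral_lyapunovSeq_eq hT.measurable hf hfr hr, lyapunovSeq_eq_div, ← sub_div]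
    gcongr
    have h3 := integral_mono ((integrable_logNorm (μ := μ) hT.measurable hf hfr
      (2 * Complex.I) n).sub (integrable_const (Real.log 4 + Real.log 2))) (hint n) fun ω => by
        simp only [logNorm_eq_logStep, Pi.sub_apply]
        exact logStep_two_I_le_integral n hr (fun k => hfr _)
    rw [integral_sub' (integrable_logNorm hT.measurable hf hfr _ n) (integrable_const _)] at h3
    simpa using h3

/-- At each energy the Lyapunov exponent is upper semicontinuous in the potential. -/
lemma tendsto_posPart_lyapunov_sub (hT : MeasurePreserving T μ μ) {g : ℕ → Ω → ℝ}
    (hf : Measurable f) (hfr : ∀ ω, |f ω| ≤ r)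
    (hgm : ∀ k, Measurable (g k)) (hgr : ∀ k ω, |g k ω| ≤ r)
    (hg : ∀ᵐ ω ∂μ, Tendsto (fun k => g k ω) atTop (𝓝 (f ω))) (E : ℂ) :
    Tendsto (fun k => max (lyapunov T μ (g k) E - lyapunov T μ f E) 0) atTop (𝓝 0) := by
  rw [Metric.tendsto_nhds]
  intro ε hε
  obtain ⟨n, hn1, hn0⟩ := (((tendsto_lyapunovSeq hT hf hfr E).eventually
    (gt_mem_nhds (lt_add_of_pos_right _ (half_pos hε)))).and (eventually_ne_atTop 0)).exists
  filter_upwards [(tendsto_lyapunovSeq_of_ae hT hgm hgr hg (tendsto_const_nhds (x := E))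
    n).eventually (gt_mem_nhds (lt_add_of_pos_right _ (half_pos hε)))] with k hk
  have h2 := lyapunov_le_lyapunovSeq hT (hgm k) (hgr k) E hn0
  rw [Real.dist_eq, sub_zero, abs_of_nonneg (le_max_right _ _)]
  exact max_lt (by linarith) hε

/-- The Lyapunov exponents on the real line depend continuously, in the mean, on the potential. -/
theorem tendsto_integral_abs_lyapunov_sub (hT : MeasurePreserving T μ μ) {g : ℕ → Ω → ℝ}
    (hf : Measurable f) (hfr : ∀ ω, |f ω| ≤ r) (hr : 0 ≤ r)
    (hgm : ∀ k, Measurable (g k)) (hgr : ∀ k ω, |g k ω| ≤ r)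
    (hg : ∀ᵐ ω ∂μ, Tendsto (fun k => g k ω) atTop (𝓝 (f ω))) :
    Tendsto (fun k => ∫ E : ℝ, |lyapunov T μ (g k) E - lyapunov T μ f E| ∂harmonicMeasure)
      atTop (𝓝 0) := by
  have hi := integrable_lyapunov hT hf hfr hr
  have hik := fun k => integrable_lyapunov hT (hgm k) (hgr k) hr
  have h1 : Tendsto (fun k => ∫ E : ℝ, max (lyapunov T μ (g k) E - lyapunov T μ f E) 0
      ∂harmonicMeasure) atTop (𝓝 (∫ _ : ℝ, 0 ∂harmonicMeasure)) := by
    refine tendsto_integral_of_dominated_convergence (growth r)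
      (fun k => ((hik k).sub hi).pos_part.aestronglyMeasurable) (integrable_growth r)
      (fun k => ae_of_all _ fun E => ?_)
      (ae_of_all _ fun E => tendsto_posPart_lyapunov_sub hT hf hfr hgm hgr hg E)
    have h2 := lyapunov_le_growth hT (hgm k) (hgr k) hr E
    rw [Real.norm_of_nonneg (le_max_right _ _)]
    exact max_le (by linarith [lyapunov_nonneg hT hf hfr E])
      ((lyapunov_nonneg hT (hgm k) (hgr k) E).trans h2)
  have h2 : Tendsto (fun k => ∫ E : ℝ, (lyapunov T μ (g k) E - lyapunov T μ f E)
      ∂harmonicMeasure) atTop (𝓝 0) := by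
    have h3 := (tendsto_lyapunov_of_ae hT hf hfr hgm hgr hg (E := 2 * Complex.I)
      (by simp)).sub_const (lyapunov T μ f (2 * Complex.I))
    rw [sub_self] at h3
    refine h3.congr fun k => ?_
    rw [integral_sub (hik k) hi, integral_lyapunov hT hf hfr hr,
      integral_lyapunov hT (hgm k) (hgr k) hr]
  -- Uses `|x| = 2 max(x, 0) - x`.
  have h3 := (h1.const_mul 2).sub h2
  simp only [integral_zero, mul_zero, sub_zero] at h3
  refine h3.congr fun k => ?_
  have hp : Integrable (fun E : ℝ => max (lyapunov T μ (g k) E - lyapunov T μ f E) 0)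
      harmonicMeasure := ((hik k).sub hi).pos_part
  have hs : Integrable (fun E : ℝ => lyapunov T μ (g k) E - lyapunov T μ f E)
      harmonicMeasure := (hik k).sub hi
  rw [← integral_const_mul, ← integral_sub (hp.const_mul 2) hs]
  refine integral_congr_ae (ae_of_all _ fun E => ?_)
  dsimp only
  rcases le_total 0 (lyapunov T μ (g k) E - lyapunov T μ f E) with h | h
  · rw [max_eq_left h, abs_of_nonneg h]; ring
  · rw [max_eq_right h, abs_of_nonpos h]; ring

lemma zeroSet_subset (hT : MeasurePreserving T μ μ) (hf : Measurable f) (hfr : ∀ ω, |f ω| ≤ r) :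
    zeroSet T μ f ⊆ Set.Icc (-(r + 2)) (r + 2) := by
  intro E hE
  refine abs_le.1 ?_
  by_contra! h
  have h1 : 0 < Real.log (|E| - r - 1) := Real.log_pos (by linarith)
  refine absurd hE (ne_of_gt (h1.trans_le ?_))
  refine ge_of_tendsto (tendsto_lyapunovSeq hT hf hfr E) ?_
  filter_upwards [eventually_gt_atTop 0] with n hn
  have hn' : (0 : ℝ) < n := by exact_mod_cast hn
  rw [lyapunovSeq_eq_div, le_div_iff₀' hn']
  have h3 := integral_mono (μ := μ) (integrable_const (n * Real.log (|E| - r - 1)))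
    (integrable_logNorm hT.measurable hf hfr E n) fun ω => by
      simp only [logNorm_eq_logStep]
      exact le_logStep_of_lt_abs n (fun k => hfr _) h.le
  simpa using h3

lemma measurableSet_zeroSet (hT : MeasurePreserving T μ μ) (hf : Measurable f)
    (hfr : ∀ ω, |f ω| ≤ r) : MeasurableSet (zeroSet T μ f) :=
  ((measurable_lyapunov hT hf hfr).comp Complex.measurable_ofReal) (measurableSet_singleton 0)

lemma zeroMeasure_le (hT : MeasurePreserving T μ μ) (hf : Measurable f)
    (hfr : ∀ ω, |f ω| ≤ r) (hr : 0 ≤ r) : zeroMeasure T μ f ≤ 2 * (r + 2) := by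
  refine (measureReal_mono (zeroSet_subset hT hf hfr) (by simp)).trans_eq ?_
  rw [Real.volume_real_Icc_of_le (by linarith)]
  ring

/-- Upper semicontinuity of the measure of the zero set, along almost everywhere convergent
sequences of uniformly bounded potentials. -/
theorem eventually_zeroMeasure_lt (hT : MeasurePreserving T μ μ) {g : ℕ → Ω → ℝ}
    (hf : Measurable f) (hfr : ∀ ω, |f ω| ≤ r) (hr : 0 ≤ r)
    (hgm : ∀ k, Measurable (g k)) (hgr : ∀ k ω, |g k ω| ≤ r)
    (hg : ∀ᵐ ω ∂μ, Tendsto (fun k => g k ω) atTop (𝓝 (f ω))) {y : ℝ}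
    (hy : zeroMeasure T μ f < y) : ∀ᶠ k in atTop, zeroMeasure T μ (g k) < y := by
  set I := Set.Icc (-(r + 2)) (r + 2) with hI
  have hIfin : volume I ≠ ⊤ := by simp [hI]
  have hm : ∀ {g : Ω → ℝ}, Measurable g → (∀ ω, |g ω| ≤ r) →
      Measurable fun E : ℝ => lyapunov T μ g E :=
    fun hg hgr => (measurable_lyapunov hT hg hgr).comp Complex.measurable_ofReal
  -- These sets decrease to the zero set as `δ` tends to `0`, inside an interval of finite length,
  -- so some `δ` still has measure below `y`.
  let Z : ℝ → Set ℝ := fun δ => I ∩ {E : ℝ | lyapunov T μ f E ≤ δ}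
  have hZm : ∀ δ, MeasurableSet (Z δ) := fun δ =>
    measurableSet_Icc.inter (measurableSet_le (hm hf hfr) measurable_const)
  obtain ⟨δ, hδ0, hδ⟩ : ∃ δ : ℝ, 0 < δ ∧ volume.real (Z δ) < y := by
    have hZ : ⋂ m : ℕ, Z (1 / ((m : ℝ) + 1)) = zeroSet T μ f := by
      ext E
      simp only [Set.mem_iInter]
      constructor
      · intro h
        exact le_antisymm (ge_of_tendsto' tendsto_one_div_add_atTop_nhds_zero_nat
          fun m => (h m).2) (lyapunov_nonneg hT hf hfr E)
      · intro h m
        refine ⟨zeroSet_subset hT hf hfr h, ?_⟩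
        have h0 : lyapunov T μ f E = 0 := h
        have : (0 : ℝ) < 1 / ((m : ℝ) + 1) := Nat.one_div_pos_of_nat
        simpa only [Set.mem_ofPred_eq, h0] using this.le
    have hlim := tendsto_measure_iInter_atTop (μ := volume) (s := fun m : ℕ => Z (1 / ((m : ℝ) + 1)))
      (fun m => (hZm _).nullMeasurableSet)
      (fun a b hab E hE => ⟨hE.1, show lyapunov T μ f E ≤ _ from
        le_trans hE.2 (Nat.one_div_le_one_div hab)⟩)
      ⟨0, measure_ne_top_of_subset Set.inter_subset_left hIfin⟩
    rw [hZ] at hlim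
    have hlim' := (ENNReal.tendsto_toReal
      (measure_ne_top_of_subset (zeroSet_subset hT hf hfr) hIfin)).comp hlim
    obtain ⟨m, hm⟩ := (hlim'.eventually (gt_mem_nhds hy)).exists
    exact ⟨_, Nat.one_div_pos_of_nat, hm⟩
  set C := Real.pi * ((r + 2) ^ 2 + 4) / 2 with hC
  have hC0 : 0 ≤ C := by positivity
  have hlim := ((tendsto_integral_abs_lyapunov_sub hT hf hfr hr hgm hgr hg).const_mul
    (C * δ⁻¹)).const_add (volume.real (Z δ))
  rw [mul_zero, add_zero] at hlim
  filter_upwards [hlim.eventually (gt_mem_nhds hδ)] with k hk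
  refine lt_of_le_of_lt ?_ hk
  let A : Set ℝ := {E : ℝ | δ ≤ |lyapunov T μ (g k) E - lyapunov T μ f E|}
  have hAm : MeasurableSet A :=
    measurableSet_le measurable_const (((hm (hgm k) (hgr k)).sub (hm hf hfr)).abs)
  -- A zero of the approximating exponent is either nearly a zero of the limit exponent or a point
  -- where the two differ by at least `δ`; Markov's inequality makes the second set small.
  have hsub : zeroSet T μ (g k) ⊆ Z δ ∪ (I ∩ A) := by
    intro E hE
    have hEI := zeroSet_subset hT (hgm k) (hgr k) hE
    by_cases h : lyapunov T μ f E ≤ δ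
    · exact Or.inl ⟨hEI, h⟩
    · refine Or.inr ⟨hEI, ?_⟩
      have h0 : lyapunov T μ (g k) E = 0 := hE
      simp only [A, Set.mem_ofPred_eq, h0, zero_sub, abs_neg]
      exact (not_le.1 h).le.trans (le_abs_self _)
  have hfin : ∀ {s : Set ℝ}, s ⊆ I → volume s ≠ ⊤ := fun hs => measure_ne_top_of_subset hs hIfin
  have hmarkov := mul_meas_ge_le_integral_of_nonneg (μ := harmonicMeasure)
    (f := fun E : ℝ => |lyapunov T μ (g k) E - lyapunov T μ f E|)
    (ae_of_all _ fun E => abs_nonneg _)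
    ((integrable_lyapunov hT (hgm k) (hgr k) hr).sub (integrable_lyapunov hT hf hfr hr)).abs δ
  have hvol : volume.real (I ∩ A) ≤ C * harmonicMeasure.real A := by
    have h1 := volume_le_harmonicMeasure (r + 2) (A := I ∩ A) Set.inter_subset_left
      (measurableSet_Icc.inter hAm)
    have h2 := ENNReal.toReal_mono
      (ENNReal.mul_ne_top ENNReal.ofReal_ne_top (measure_ne_top _ _)) h1
    rw [ENNReal.toReal_mul, ENNReal.toReal_ofReal hC0] at h2
    refine h2.trans ?_
    gcongr
    exact measureReal_mono Set.inter_subset_right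
  calc zeroMeasure T μ (g k) ≤ volume.real (Z δ ∪ (I ∩ A)) :=
        measureReal_mono hsub (hfin (Set.union_subset Set.inter_subset_left Set.inter_subset_left))
    _ ≤ volume.real (Z δ) + volume.real (I ∩ A) := measureReal_union_le _ _
    _ ≤ volume.real (Z δ) + C * harmonicMeasure.real A := by gcongr
    _ ≤ _ := by
      rw [mul_assoc]
      gcongr
      rw [← div_eq_inv_mul, le_div_iff₀' hδ0]
      exact hmarkov

end Ergodic
end SchrodingerCocycle

/-! ### Representatives, `L¹` convergence and the coupling constant -/

namespace SchrodingerCocycle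

section Congr
variable {Ω : Type*} [MeasurableSpace Ω] {T : Ω → Ω} {μ : Measure Ω} {f g : Ω → ℝ}

/-- Invariance of the measure keeps the exceptional set null along whole orbits, so everything
descends to classes of functions. -/
lemma logNorm_congr_ae (hT : MeasurePreserving T μ μ) (h : f =ᵐ[μ] g) (E : ℂ) (n : ℕ) :
    logNorm T f E n =ᵐ[μ] logNorm T g E n := by
  have h' : ∀ᵐ ω ∂μ, ∀ j, f (T^[j] ω) = g (T^[j] ω) :=
    ae_all_iff.2 fun j => (hT.iterate j).quasiMeasurePreserving.ae h
  filter_upwards [h'] with ω hω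
  simp only [logNorm_eq_logStep, hω]

lemma lyapunovSeq_congr_ae (hT : MeasurePreserving T μ μ) (h : f =ᵐ[μ] g) :
    lyapunovSeq T μ f = lyapunovSeq T μ g := by
  ext E n
  rw [lyapunovSeq, lyapunovSeq, integral_congr_ae (logNorm_congr_ae hT h E n)]

lemma lyapunov_congr_ae (hT : MeasurePreserving T μ μ) (h : f =ᵐ[μ] g) :
    lyapunov T μ f = lyapunov T μ g := by
  ext E
  rw [lyapunov, lyapunov, lyapunovSeq_congr_ae hT h]

lemma zeroSet_congr_ae (hT : MeasurePreserving T μ μ) (h : f =ᵐ[μ] g) :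
    zeroSet T μ f = zeroSet T μ g := by
  rw [zeroSet, zeroSet, lyapunov_congr_ae hT h]

lemma zeroMeasure_congr_ae (hT : MeasurePreserving T μ μ) (h : f =ᵐ[μ] g) :
    zeroMeasure T μ f = zeroMeasure T μ g := by
  rw [zeroMeasure, zeroMeasure, zeroSet_congr_ae hT h]

end Congr

section Truncation

/-- Truncation of a real number to the interval `[-r, r]`. -/
noncomputable def clamp (r x : ℝ) : ℝ := max (-r) (min r x)

lemma abs_clamp_le {r : ℝ} (hr : 0 ≤ r) (x : ℝ) : |clamp r x| ≤ r :=
  abs_le.2 ⟨le_max_left _ _, max_le (by linarith) (min_le_left _ _)⟩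

lemma clamp_of_abs_le {r x : ℝ} (h : |x| ≤ r) : clamp r x = x := by
  rw [clamp, min_eq_right (abs_le.1 h).2, max_eq_right (abs_le.1 h).1]

lemma continuous_clamp (r : ℝ) : Continuous (clamp r) :=
  continuous_const.max (continuous_const.min continuous_id)

variable {Ω : Type*} [MeasurableSpace Ω] {μ : Measure Ω} {r : ℝ}

lemma measurable_clamp_coeFn (f : Lp ℝ 1 μ) : Measurable fun ω => clamp r (f ω) :=
  (continuous_clamp r).measurable.comp (Lp.stronglyMeasurable f).measurable

/-- Supplies a representative bounded everywhere, as the preceding estimates require. -/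
lemma coeFn_ae_eq_clamp (hr : 0 ≤ r) {f : Lp ℝ 1 μ} (hf : f ∈ linftyBall μ r) :
    (f : Ω → ℝ) =ᵐ[μ] fun ω => clamp r (f ω) := by
  have hf' : eLpNorm f ⊤ μ ≤ ENNReal.ofReal r := hf
  rw [eLpNorm_exponent_top] at hf'
  filter_upwards [ae_le_eLpNormEssSup (f := (f : Ω → ℝ)) (μ := μ)] with ω hω
  refine (clamp_of_abs_le ?_).symm
  have h := hω.trans hf'
  rw [← ofReal_norm, ENNReal.ofReal_le_ofReal_iff hr, Real.norm_eq_abs] at h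
  exact h

lemma coeFn_smul_ae_eq_clamp (hr : 0 ≤ r) {f : Lp ℝ 1 μ} (hf : f ∈ linftyBall μ r) (l : ℝ) :
    ((l • f : Lp ℝ 1 μ) : Ω → ℝ) =ᵐ[μ] fun ω => l * clamp r (f ω) := by
  filter_upwards [Lp.coeFn_smul l f, coeFn_ae_eq_clamp hr hf] with ω h1 h2
  rw [h1, Pi.smul_apply, smul_eq_mul, ← h2]

/-- A functional on a ball of `L^∞` is upper semicontinuous for the `L¹` distance if it is so along
almost everywhere convergent sequences. -/
lemma upperSemicontinuousOn_linftyBall {Φ : Lp ℝ 1 μ → ℝ}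
    (h : ∀ f ∈ linftyBall μ r, ∀ g : ℕ → Lp ℝ 1 μ, (∀ k, g k ∈ linftyBall μ r) →
      (∀ᵐ ω ∂μ, Tendsto (fun k => g k ω) atTop (𝓝 (f ω))) → ∀ y, Φ f < y →
      ∀ᶠ k in atTop, Φ (g k) < y) : UpperSemicontinuousOn Φ (linftyBall μ r) := by
  intro f hf y hy
  by_contra hne
  obtain ⟨g, hg, hgy⟩ := exists_seq_forall_of_frequently
    ((not_eventually.1 hne).and_eventually self_mem_nhdsWithin)
  -- A violating sequence converges in `L¹`, hence in measure, hence almost everywhere along a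
  -- subsequence, which still violates the bound.
  have hm := tendstoInMeasure_of_tendsto_Lp (tendsto_nhds_of_tendsto_nhdsWithin hg)
  obtain ⟨s, -, hs⟩ := hm.exists_seq_tendsto_ae
  obtain ⟨k, hk⟩ := (h f hf (fun k => g (s k)) (fun k => (hgy _).2) hs y hy).exists
  exact (hgy (s k)).1 hk

end Truncation

section Coupling
variable {Ω : Type*} [MeasurableSpace Ω] {T : Ω → Ω} {μ : Measure Ω} [IsProbabilityMeasure μ]
  {F : Ω → ℝ} {r : ℝ}

/-- Needed for measurability in the coupling constant. -/
lemma upperSemicontinuous_zeroMeasure_mul (hT : MeasurePreserving T μ μ) (hF : Measurable F)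
    (hFr : ∀ ω, |F ω| ≤ r) (hr : 0 ≤ r) :
    UpperSemicontinuous fun l : ℝ => zeroMeasure T μ fun ω => l * F ω := by
  intro l y hy
  by_contra hne
  obtain ⟨s, hs, hsy⟩ := exists_seq_forall_of_frequently (not_eventually.1 hne)
  obtain ⟨R, hR⟩ := (Metric.isBounded_range_of_tendsto s hs).exists_norm_le
  have hR' : ∀ k, |s k| ≤ R := fun k => hR _ (Set.mem_range_self k)
  have hl : |l| ≤ R := le_of_tendsto' hs.abs hR'
  have hR0 : 0 ≤ R := (abs_nonneg l).trans hl
  have hb : ∀ {t : ℝ}, |t| ≤ R → ∀ ω, |t * F ω| ≤ R * r := fun ht ω => by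
    rw [abs_mul]
    exact mul_le_mul ht (hFr ω) (abs_nonneg _) hR0
  obtain ⟨k, hk⟩ := (eventually_zeroMeasure_lt hT (hF.const_mul l) (hb hl) (mul_nonneg hR0 hr)
    (fun k => hF.const_mul (s k)) (fun k => hb (hR' k))
    (ae_of_all _ fun ω => hs.mul_const (F ω)) hy).exists
  exact hsy k hk

lemma abs_mul_le_of_mem_Icc {Λ l x : ℝ} (hl : l ∈ Set.Icc 0 Λ) (hx : |x| ≤ r) :
    |l * x| ≤ Λ * r := by
  rw [abs_mul, abs_of_nonneg hl.1]
  exact mul_le_mul hl.2 hx (abs_nonneg _) (hl.1.trans hl.2)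

lemma zeroMeasure_nonneg (T : Ω → Ω) (μ : Measure Ω) (f : Ω → ℝ) : 0 ≤ zeroMeasure T μ f :=
  measureReal_nonneg

lemma intervalIntegrable_zeroMeasure_mul (hT : MeasurePreserving T μ μ) (hF : Measurable F)
    (hFr : ∀ ω, |F ω| ≤ r) (hr : 0 ≤ r) {Λ : ℝ} (hΛ : 0 ≤ Λ) :
    IntervalIntegrable (fun l : ℝ => zeroMeasure T μ fun ω => l * F ω) volume 0 Λ := by
  rw [intervalIntegrable_iff_integrableOn_Icc_of_le hΛ]
  refine Measure.integrableOn_of_bounded (M := 2 * (Λ * r + 2)) (by simp)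
    (upperSemicontinuous_zeroMeasure_mul hT hF hFr hr).measurable.aestronglyMeasurable ?_
  rw [ae_restrict_iff' measurableSet_Icc]
  refine ae_of_all _ fun l hl => ?_
  rw [Real.norm_of_nonneg (zeroMeasure_nonneg _ _ _)]
  exact zeroMeasure_le hT (hF.const_mul l) (fun ω => abs_mul_le_of_mem_Icc hl (hFr ω))
    (mul_nonneg hΛ hr)

/-- A reverse Fatou argument: for each coupling the positive part of the difference tends to `0` by
semicontinuity, under a uniform bound, and it dominates the difference. -/
lemma eventually_integral_zeroMeasure_mul_lt (hT : MeasurePreserving T μ μ) {G : ℕ → Ω → ℝ}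
    (hF : Measurable F) (hFr : ∀ ω, |F ω| ≤ r) (hr : 0 ≤ r) (hGm : ∀ k, Measurable (G k))
    (hGr : ∀ k ω, |G k ω| ≤ r) (hG : ∀ᵐ ω ∂μ, Tendsto (fun k => G k ω) atTop (𝓝 (F ω)))
    {Λ : ℝ} (hΛ : 0 ≤ Λ) {y : ℝ} (hy : ∫ l in (0 : ℝ)..Λ, zeroMeasure T μ (fun ω => l * F ω) < y) :
    ∀ᶠ k in atTop, ∫ l in (0 : ℝ)..Λ, zeroMeasure T μ (fun ω => l * G k ω) < y := by
  have hi := intervalIntegrable_zeroMeasure_mul hT hF hFr hr hΛ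
  have hik := fun k => intervalIntegrable_zeroMeasure_mul hT (hGm k) (hGr k) hr hΛ
  have hm := (upperSemicontinuous_zeroMeasure_mul hT hF hFr hr).measurable
  have hmk := fun k => (upperSemicontinuous_zeroMeasure_mul hT (hGm k) (hGr k) hr).measurable
  have hmax := fun k => ((hmk k).sub hm).max (measurable_const (a := (0 : ℝ)))
  have hle : ∀ k, ∀ l ∈ Set.Icc 0 Λ, max (zeroMeasure T μ (fun ω => l * G k ω) -
      zeroMeasure T μ (fun ω => l * F ω)) 0 ≤ 2 * (Λ * r + 2) := by
    intro k l hl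
    have h1 := zeroMeasure_le hT ((hGm k).const_mul l)
      (fun ω => abs_mul_le_of_mem_Icc hl (hGr k ω)) (mul_nonneg hΛ hr)
    exact max_le (by linarith [zeroMeasure_nonneg T μ fun ω => l * F ω])
      ((zeroMeasure_nonneg _ _ _).trans h1)
  have hIoc : Set.uIoc 0 Λ ⊆ Set.Icc 0 Λ := by
    rw [Set.uIoc_of_le hΛ]
    exact Set.Ioc_subset_Icc_self
  have hlim : Tendsto (fun k => ∫ l in (0 : ℝ)..Λ, max (zeroMeasure T μ (fun ω => l * G k ω) -
      zeroMeasure T μ (fun ω => l * F ω)) 0) atTop (𝓝 (∫ _ in (0 : ℝ)..Λ, 0)) := by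
    refine intervalIntegral.tendsto_integral_filter_of_dominated_convergence
      (fun _ => 2 * (Λ * r + 2)) (Eventually.of_forall fun k => (hmax k).aestronglyMeasurable)
      (Eventually.of_forall fun k => ae_of_all _ fun l hl => ?_) intervalIntegrable_const
      (ae_of_all _ fun l hl => ?_)
    · rw [Real.norm_of_nonneg (le_max_right _ _)]
      exact hle k l (hIoc hl)
    · rw [Metric.tendsto_nhds]
      intro ε hε
      filter_upwards [eventually_zeroMeasure_lt hT (hF.const_mul l)
        (fun ω => abs_mul_le_of_mem_Icc (hIoc hl) (hFr ω)) (mul_nonneg hΛ hr)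
        (fun k => (hGm k).const_mul l)
        (fun k ω => abs_mul_le_of_mem_Icc (hIoc hl) (hGr k ω))
        (hG.mono fun ω h => h.const_mul l) (lt_add_of_pos_right _ hε)] with k hk
      rw [Real.dist_eq, sub_zero, abs_of_nonneg (le_max_right _ _)]
      exact max_lt (by linarith) hε
  rw [intervalIntegral.integral_zero] at hlim
  filter_upwards [hlim.eventually (gt_mem_nhds (sub_pos.2 hy))] with k hk
  have hmi : IntervalIntegrable (fun l => max (zeroMeasure T μ (fun ω => l * G k ω) -
      zeroMeasure T μ (fun ω => l * F ω)) 0) volume 0 Λ := by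
    rw [intervalIntegrable_iff]
    exact ((intervalIntegrable_iff.1 (hik k)).sub (intervalIntegrable_iff.1 hi)).pos_part
  have hmono := intervalIntegral.integral_mono hΛ ((hik k).sub hi) hmi fun l => le_max_left _ _
  rw [intervalIntegral.integral_sub (hik k) hi] at hmono
  linarith

end Coupling

end SchrodingerCocycle

/-! ### The theorem, through truncated representatives -/

open SchrodingerCocycle in
theorem lemma2p1 {Ω : Type*} [MetricSpace Ω] [CompactSpace Ω] [MeasurableSpace Ω] [BorelSpace Ω]
    (T : Ω ≃ₜ Ω) (μ : Measure Ω) [IsProbabilityMeasure μ] (hT : Ergodic T μ)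
    (hμ : ∀ ω : Ω, μ {ω} = 0) (r Λ : ℝ) (hr : 0 < r) (hΛ : 0 < Λ) :
    -- the Lyapunov exponent and the two maps are well defined
    (∀ f ∈ SchrodingerCocycle.linftyBall μ r,
      (∀ E : ℂ, (∀ n : ℕ, Integrable (SchrodingerCocycle.logNorm T f E n) μ) ∧
        Tendsto (SchrodingerCocycle.lyapunovSeq T μ f E) atTop
          (𝓝 (SchrodingerCocycle.lyapunov T μ f E))) ∧
      MeasurableSet (SchrodingerCocycle.zeroSet T μ f) ∧
      volume (SchrodingerCocycle.zeroSet T μ f) < ⊤ ∧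
      IntervalIntegrable (fun l : ℝ => SchrodingerCocycle.zeroMeasure T μ (l • f : Lp ℝ 1 μ))
        volume 0 Λ) ∧
    -- both maps are upper semicontinuous
    UpperSemicontinuousOn (fun f : Lp ℝ 1 μ => SchrodingerCocycle.zeroMeasure T μ f)
      (SchrodingerCocycle.linftyBall μ r) ∧
    UpperSemicontinuousOn
      (fun f : Lp ℝ 1 μ => ∫ l in (0 : ℝ)..Λ, SchrodingerCocycle.zeroMeasure T μ (l • f : Lp ℝ 1 μ))
      (SchrodingerCocycle.linftyBall μ r) := by
  have hmp : MeasurePreserving T μ μ := hT.toMeasurePreserving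
  have hb := fun (f : Lp ℝ 1 μ) (ω : Ω) => abs_clamp_le hr.le (f ω)
  have hm := fun f : Lp ℝ 1 μ => measurable_clamp_coeFn (r := r) f
  have hsmul : ∀ f ∈ linftyBall μ r, ∀ l : ℝ, zeroMeasure T μ (l • f : Lp ℝ 1 μ) =
      zeroMeasure T μ fun ω => l * clamp r (f ω) :=
    fun f hf l => zeroMeasure_congr_ae hmp (coeFn_smul_ae_eq_clamp hr.le hf l)
  refine ⟨fun f hf => ?_, ?_, ?_⟩
  · have hae := coeFn_ae_eq_clamp hr.le hf
    simp only [hsmul f hf]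
    rw [zeroSet_congr_ae hmp hae, lyapunovSeq_congr_ae hmp hae, lyapunov_congr_ae hmp hae]
    refine ⟨fun E => ⟨fun n => ?_, tendsto_lyapunovSeq hmp (hm f) (hb f) E⟩,
      measurableSet_zeroSet hmp (hm f) (hb f), ?_,
      intervalIntegrable_zeroMeasure_mul hmp (hm f) (hb f) hr.le hΛ.le⟩
    · exact (integrable_logNorm hmp.measurable (hm f) (hb f) E n).congr
        (logNorm_congr_ae hmp hae E n).symm
    · exact (measure_mono (zeroSet_subset hmp (hm f) (hb f))).trans_lt measure_Icc_lt_top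
  · refine upperSemicontinuousOn_linftyBall fun f hf g hg hgf y hy => ?_
    rw [zeroMeasure_congr_ae hmp (coeFn_ae_eq_clamp hr.le hf)] at hy
    filter_upwards [eventually_zeroMeasure_lt hmp (hm f) (hb f) hr.le (fun k => hm (g k))
      (fun k => hb (g k)) (hgf.mono fun ω h => ((continuous_clamp r).tendsto _).comp h) hy] with k hk
    rwa [zeroMeasure_congr_ae hmp (coeFn_ae_eq_clamp hr.le (hg k))]
  · refine upperSemicontinuousOn_linftyBall fun f hf g hg hgf y hy => ?_
    simp only [hsmul f hf] at hy
    filter_upwards [eventually_integral_zeroMeasure_mul_lt hmp (hm f) (hb f) hr.le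
      (fun k => hm (g k)) (fun k => hb (g k))
      (hgf.mono fun ω h => ((continuous_clamp r).tendsto _).comp h) hΛ.le hy] with k hk
    simpa only [hsmul (g k) (hg k)] using hk
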